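/- Let $\alpha>0$ and let $m_*,n_*\ge 1$ be integers. Consider the Dirichlet Laplacian $-\Delta$ on $L^2(R_\alpha)$, $R_\alpha=[0,\alpha\pi]\times[0,\pi]$, that is, the self-adjoint operator associated with the form $\int\nabla u\cdot\nabla v$ on $H^1_0(R_\alpha)$. Its eigenvalues can be listed, in exactly one way, as a sequence $\lambda_1\le\lambda_2\le\lambda_3\le\cdots$ in which each eigenvalue is repeated according to its (finite) multiplicity. Put $\lambda_*=(m_*/\alpha)^2+n_*^2$ and $\phi_*(x,y)=\sin(m_*x/\alpha)\,\sin(n_*y)$. Then $\phi_*$ is an eigenfunction with eigenvalue $\lambda_*$, it has finitely many nodal domains (connected components of the set of points of the interior of $R_\alpha$ where $\phi_*\ne0$), and its nodal deficiency $$\delta(\phi_*)=k_*-\nu(\phi_*),\qquad k_*=\min\{k\ge 1:\lambda_k=\lambda_*\},$$ where $\nu(\phi_*)$ is the number of nodal domains of $\phi_*$, is equal to the (finite) number of points of $\mathbb Z^2$ that lie in $E_*\setminus R_*$, where $$E_*=\{(x,y): x>0,\ y>0,\ (x/\alpha)^2+y^2<\lambda_*\},\qquad R_*=\{(x,y): 0<x\le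 m_*,\ 0<y\le n_*\}.$$ This holds whether or not the eigenvalue $\lambda_*$ is simple. -/

import Mathlib

open MeasureTheory Set
open scoped ContDiff

noncomputable section

namespace DirichletNodal

/-- The real Hilbert space `L²(Ω)`, with Lebesgue measure on the plane. -/
abbrev L2 (Ω : Set (ℝ × ℝ)) : Type := Lp ℝ 2 ((volume : Measure (ℝ × ℝ)).restrict Ω)

/-- `φ ∈ C_c^∞(Ω)`. -/
structure IsTestFunction (Ω : Set (ℝ × ℝ)) (φ : ℝ × ℝ → ℝ) : Prop where
  smooth : ContDiff ℝ ∞ φ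
  compact : HasCompactSupport φ
  support : tsupport φ ⊆ Ω

/-- `∂φ/∂x`. -/
def dx (φ : ℝ × ℝ → ℝ) (p : ℝ × ℝ) : ℝ := fderiv ℝ φ p (1, 0)

/-- `∂φ/∂y`. -/
def dy (φ : ℝ × ℝ → ℝ) (p : ℝ × ℝ) : ℝ := fderiv ℝ φ p (0, 1)

/-- All triples of `L²` classes `(φ, ∂φ/∂x, ∂φ/∂y)` with `φ ∈ C_c^∞(Ω)`. -/
def testGraph (Ω : Set (ℝ × ℝ)) : Submodule ℝ (L2 Ω × L2 Ω × L2 Ω) where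
  carrier := {w | ∃ φ : ℝ × ℝ → ℝ, IsTestFunction Ω φ ∧
    w.1 =ᵐ[volume.restrict Ω] φ ∧
    w.2.1 =ᵐ[volume.restrict Ω] dx φ ∧
    w.2.2 =ᵐ[volume.restrict Ω] dy φ}
  add_mem' := by
    rintro ⟨a, a₁, a₂⟩ ⟨b, b₁, b₂⟩ ⟨φ, hφ, ha, ha₁, ha₂⟩ ⟨ψ, hψ, hb, hb₁, hb₂⟩
    have hdφ : Differentiable ℝ φ := hφ.smooth.differentiable (by simp)
    have hdψ : Differentiable ℝ ψ := hψ.smooth.differentiable (by simp)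
    refine ⟨φ + ψ, ⟨hφ.smooth.add hψ.smooth, hφ.compact.add hψ.compact,
      (tsupport_add φ ψ).trans (union_subset hφ.support hψ.support)⟩, ?_, ?_, ?_⟩
    · exact (Lp.coeFn_add a b).trans (ha.add hb)
    · refine (Lp.coeFn_add a₁ b₁).trans ((ha₁.add hb₁).trans (.of_forall fun p => ?_))
      simp [dx, fderiv_add (hdφ p) (hdψ p)]
    · refine (Lp.coeFn_add a₂ b₂).trans ((ha₂.add hb₂).trans (.of_forall fun p => ?_))
      simp [dy, fderiv_add (hdφ p) (hdψ p)]
  zero_mem' := by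
    refine ⟨0, ⟨contDiff_const, HasCompactSupport.zero, by simp⟩, ?_, ?_, ?_⟩
    · exact Lp.coeFn_zero _ _ _
    · refine (Lp.coeFn_zero _ _ _).trans (.of_forall fun p => ?_)
      simp [dx]
    · refine (Lp.coeFn_zero _ _ _).trans (.of_forall fun p => ?_)
      simp [dy]
  smul_mem' := by
    rintro c ⟨a, a₁, a₂⟩ ⟨φ, hφ, ha, ha₁, ha₂⟩
    have hdφ : Differentiable ℝ φ := hφ.smooth.differentiable (by simp)
    refine ⟨c • φ, ⟨contDiff_const.smul hφ.smooth, hφ.compact.smul_left,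
      (closure_mono (Function.support_const_smul_subset c φ)).trans hφ.support⟩, ?_, ?_, ?_⟩
    · exact (Lp.coeFn_smul c a).trans (ha.const_smul c)
    · refine (Lp.coeFn_smul c a₁).trans ((ha₁.const_smul c).trans (.of_forall fun p => ?_))
      simp [dx, fderiv_const_smul (hdφ p)]
    · refine (Lp.coeFn_smul c a₂).trans ((ha₂.const_smul c).trans (.of_forall fun p => ?_))
      simp [dy, fderiv_const_smul (hdφ p)]

/-- The Sobolev space `H¹₀(Ω)`, each `u` being recorded together with its weak gradient as
`(u, ∂u/∂x, ∂u/∂y)`: the closure of `C_c^∞(Ω)` in the `H¹` norm. -/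
def H10 (Ω : Set (ℝ × ℝ)) : Submodule ℝ (L2 Ω × L2 Ω × L2 Ω) :=
  (testGraph Ω).topologicalClosure

/-- The graph of the Dirichlet Laplacian `-Δ` on `L²(Ω)`, that is, of the self-adjoint operator
of the form `∫ ∇u · ∇v` on `H¹₀(Ω)`: the pairs `(u, f)` with `u ∈ H¹₀(Ω)`, `f ∈ L²(Ω)` and
`∫ ∇u · ∇v = ∫ f v` for all `v ∈ H¹₀(Ω)`. -/
def dirichletLaplacianGraph (Ω : Set (ℝ × ℝ)) : Submodule ℝ (L2 Ω × L2 Ω) where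
  carrier := {z | ∃ g : L2 Ω × L2 Ω, (z.1, g) ∈ H10 Ω ∧
    ∀ v ∈ H10 Ω, inner ℝ g.1 v.2.1 + inner ℝ g.2 v.2.2 = inner ℝ z.2 v.1}
  add_mem' := by
    rintro ⟨u, f⟩ ⟨u', f'⟩ ⟨g, hg, h⟩ ⟨g', hg', h'⟩
    refine ⟨g + g', (H10 Ω).add_mem hg hg', fun v hv => ?_⟩
    have h₁ := h v hv
    have h₂ := h' v hv
    simp only [Prod.fst_add, Prod.snd_add, inner_add_left] at h₁ h₂ ⊢
    linarith
  zero_mem' := ⟨0, (H10 Ω).zero_mem, fun v _ => by simp⟩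
  smul_mem' := by
    rintro c ⟨u, f⟩ ⟨g, hg, h⟩
    refine ⟨c • g, (H10 Ω).smul_mem c hg, fun v hv => ?_⟩
    have h₁ := h v hv
    simp only [Prod.smul_fst, Prod.smul_snd, real_inner_smul_left] at h₁ ⊢
    rw [← h₁, mul_add]

/-- `ker (Δ + μ)`: the `u` in the domain of the Dirichlet Laplacian with `-Δ u = μ u`. -/
def eigenspace (Ω : Set (ℝ × ℝ)) (μ : ℝ) : Submodule ℝ (L2 Ω) :=
  (dirichletLaplacianGraph Ω).comap (LinearMap.prod LinearMap.id (μ • LinearMap.id))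

/-- The function `φ` represents a nonzero eigenvector of the Dirichlet Laplacian on `Ω`
with eigenvalue `μ`. -/
def IsEigenfunction (Ω : Set (ℝ × ℝ)) (μ : ℝ) (φ : ℝ × ℝ → ℝ) : Prop :=
  ∃ u ∈ eigenspace Ω μ, u ≠ 0 ∧ u =ᵐ[volume.restrict Ω] φ

/-- `lam 1 ≤ lam 2 ≤ lam 3 ≤ ⋯` lists the eigenvalues of the Dirichlet Laplacian on `Ω`, each
repeated according to its multiplicity (and contains no other numbers). -/
structure IsEigenvalueSequence (Ω : Set (ℝ × ℝ)) (lam : ℕ+ → ℝ) : Prop where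
  monotone : Monotone lam
  multiplicity : ∀ μ : ℝ,
    {k : ℕ+ | lam k = μ}.encard = Cardinal.toENat (Module.rank ℝ (eigenspace Ω μ))

/-- The smallest index `k ≥ 1` with `lam k = μ` (used only if there is one). -/
def firstIndex (lam : ℕ+ → ℝ) (μ : ℝ) : ℕ :=
  sInf {k : ℕ | ∃ h : 0 < k, lam ⟨k, h⟩ = μ}

/-- The nodal domains of `φ` in `Ω`: the connected components of `{p ∈ Ω | φ p ≠ 0}`. -/
abbrev NodalDomain (Ω : Set (ℝ × ℝ)) (φ : ℝ × ℝ → ℝ) : Type :=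
  ConnectedComponents {p : ℝ × ℝ // p ∈ Ω ∧ φ p ≠ 0}

/-- The nodal deficiency `k - ν(φ)` of an eigenfunction `φ` with eigenvalue `μ`, where
`k = min {j | lam j = μ}`, `lam` is the eigenvalue sequence, and `ν(φ)` is the number of
nodal domains. -/
def nodalDeficiency (Ω : Set (ℝ × ℝ)) (lam : ℕ+ → ℝ) (μ : ℝ) (φ : ℝ × ℝ → ℝ) : ℤ :=
  (firstIndex lam μ : ℤ) - (Nat.card (NodalDomain Ω φ) : ℤ)

/-- The interior of the rectangle `[0, απ] × [0, π]`. -/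
def rectangle (α : ℝ) : Set (ℝ × ℝ) := Ioo 0 (α * Real.pi) ×ˢ Ioo 0 Real.pi

/-- The function `sin (m x / α) sin (n y)`. -/
def sineMode (α : ℝ) (m n : ℕ) (p : ℝ × ℝ) : ℝ :=
  Real.sin (m * p.1 / α) * Real.sin (n * p.2)

/-- The number `(m / α)² + n²`. -/
def modeEigenvalue (α : ℝ) (m n : ℕ) : ℝ := ((m : ℝ) / α) ^ 2 + (n : ℝ) ^ 2

/-- The open quarter ellipse `x > 0`, `y > 0`, `(x / α)² + y² < μ`. -/
def quarterEllipse (α μ : ℝ) : Set (ℝ × ℝ) :=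
  {p | 0 < p.1 ∧ 0 < p.2 ∧ (p.1 / α) ^ 2 + p.2 ^ 2 < μ}

/-- The rectangle `0 < x ≤ m`, `0 < y ≤ n`. -/
def indexRectangle (m n : ℕ) : Set (ℝ × ℝ) := Ioc 0 (m : ℝ) ×ˢ Ioc 0 (n : ℝ)

/-- The points of `ℤ²` that lie in the region `S` of the plane. -/
def latticePoints (S : Set (ℝ × ℝ)) : Set (ℤ × ℤ) := {q | ((q.1 : ℝ), (q.2 : ℝ)) ∈ S}

end DirichletNodal

end

/-! Separation of variables gives the whole spectrum, and the rest is counting. The modes sin(jx/α)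
sin(ky), j, k ≥ 1, are eigenfunctions with eigenvalue (j/α)² + k²; they are pairwise orthogonal and
total in L², so the multiplicity of μ is the number of index pairs (j, k) with (j/α)² + k² = μ
(`toENat_rank_eigenspace_rectangle`). Sublevel sets of this value are finite, so exactly one
nondecreasing sequence has these multiplicities, and k_* = N + 1, where N counts the pairs of value
strictly below λ_*, that is, the lattice points of E_* (`firstIndex_eq`). Every pair of R_* except
its corner (m, n) lies in E_*, so N + 1 = mn + #(E_* \ R_*) (`ncard_modeEigenvalue_lt`). The zero
lines of φ_* cut the rectangle into mn open cells, so ν = mn (`nodalDomain_sineMode`). Only strict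
inequality with λ_* enters, so its multiplicity plays no role.

The analytic work is in two places. A mode is not compactly supported, so
`mem_H10_of_eq_zero_on_frontier` truncates its values near zero. Totality
(`eq_zero_of_inner_mode_eq_zero`) comes from Stone–Weierstrass: polynomials in cos(x/α) and cos y
map the span of the modes into itself and are uniformly dense on the closed rectangle. -/

noncomputable section

namespace DirichletNodal

/-! ### Membership in H¹₀ by truncation of values -/

/-- Bounded convergence in `L²` of a finite measure. -/
lemma tendsto_toLp_two_of_bounded {X : Type*} [MeasurableSpace X] {μ : Measure X}
    [IsFiniteMeasure μ] {f : ℕ → X → ℝ} {g : X → ℝ} (C : ℝ)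
    (hf : ∀ n, MemLp (f n) 2 μ) (hg : MemLp g 2 μ)
    (hbf : ∀ n, ∀ᵐ x ∂μ, |f n x| ≤ C) (hbg : ∀ᵐ x ∂μ, |g x| ≤ C)
    (hlim : ∀ᵐ x ∂μ, Filter.Tendsto (fun n => f n x) Filter.atTop (nhds (g x))) :
    Filter.Tendsto (fun n => (hf n).toLp (f n)) Filter.atTop (nhds (hg.toLp g)) := by
  rw [tendsto_iff_norm_sub_tendsto_zero]
  have key : ∀ n, ‖(hf n).toLp (f n) - hg.toLp g‖ ^ 2 = ∫ x, (f n x - g x) ^ 2 ∂μ := by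
    intro n
    rw [← MemLp.toLp_sub, ← real_inner_self_eq_norm_sq, L2.inner_def]
    refine integral_congr_ae ?_
    filter_upwards [((hf n).sub hg).coeFn_toLp] with x hx
    rw [hx]
    simp [pow_two]
  have hsq : Filter.Tendsto (fun n => ‖(hf n).toLp (f n) - hg.toLp g‖ ^ 2)
      Filter.atTop (nhds 0) := by
    simp only [key]
    have h0 : (0 : ℝ) = ∫ _x, (0 : ℝ) ∂μ := by simp
    rw [h0]
    refine tendsto_integral_of_dominated_convergence (fun _ => (C + C) ^ 2) ?_
      (integrable_const _) ?_ ?_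
    · exact fun n => ((hf n).1.sub hg.1).pow 2
    · intro n
      filter_upwards [hbf n, hbg] with x h1 h2
      rw [Real.norm_eq_abs, abs_pow]
      exact pow_le_pow_left₀ (abs_nonneg _) ((abs_sub _ _).trans (add_le_add h1 h2)) 2
    · filter_upwards [hlim] with x hx
      simpa using (hx.sub_const (g x)).pow 2
  have := hsq.sqrt
  simpa [Real.sqrt_sq (norm_nonneg _)] using this

/-- A smooth function that vanishes near `0` and is the identity near infinity. -/
lemma exists_smooth_truncation : ∃ T : ℝ → ℝ, ContDiff ℝ ∞ T ∧ (∀ s, |s| ≤ 1 → T s = 0) ∧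
    (∀ s, 2 < |s| → T s = s ∧ deriv T s = 1) ∧ (∀ s, |T s| ≤ |s|) ∧ ∃ C, ∀ s, |deriv T s| ≤ C := by
  -- T(s) = s - s χ(s), with χ = 1 on [-1, 1] and χ = 0 off (-2, 2). The derivative of s χ(s) is
  -- continuous with compact support, so T' is bounded.
  let χ : ContDiffBump (0 : ℝ) := ⟨1, 2, one_pos, one_lt_two⟩
  have hχ : ContDiff ℝ ∞ (χ : ℝ → ℝ) := χ.contDiff
  have hprod : ContDiff ℝ ∞ (fun s : ℝ => s * χ s) := contDiff_id.mul hχ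
  have hcs : HasCompactSupport (fun s : ℝ => s * χ s) := χ.hasCompactSupport.mul_left
  have hT : ContDiff ℝ ∞ (fun s : ℝ => s - s * χ s) := contDiff_id.sub hprod
  have hT' : ∀ s, deriv (fun s : ℝ => s - s * χ s) s = 1 - deriv (fun s : ℝ => s * χ s) s := by
    intro s
    have := deriv_fun_sub (f := fun s : ℝ => s) (x := s) differentiableAt_id
      ((hprod.differentiable (by simp)) s)
    simpa using this
  refine ⟨fun s => s - s * χ s, hT, fun s hs => ?_, fun s hs => ?_, fun s => ?_, ?_⟩
  · have : χ s = 1 := χ.one_of_mem_closedBall (by simpa using hs)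
    simp [this]
  · have hz : ∀ t : ℝ, 2 < |t| → χ t = 0 := fun t ht =>
      χ.zero_of_le_dist (by simpa using ht.le)
    refine ⟨by simp [hz s hs], ?_⟩
    -- The strict inequality 2 < |s| is an open condition, so T is the identity near s.
    rw [Filter.EventuallyEq.deriv_eq (f := fun t : ℝ => t) ?_]
    · simp
    · filter_upwards [(isOpen_lt continuous_const continuous_abs).mem_nhds hs] with t ht
      simp [hz t ht]
  · have h0 : 0 ≤ χ s := χ.nonneg
    have h1 : χ s ≤ 1 := χ.le_one
    have : s - s * χ s = s * (1 - χ s) := by ring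
    simp only [this, abs_mul]
    refine mul_le_of_le_one_right (abs_nonneg _) ?_
    rw [abs_le]; constructor <;> linarith
  · obtain ⟨C, hC⟩ := (hprod.continuous_deriv (by simp)).bounded_above_of_compact_support hcs.deriv
    refine ⟨1 + C, fun s => ?_⟩
    rw [hT']
    refine (abs_sub _ _).trans ?_
    simpa using hC s

lemma memLp_two_of_continuous {Ω : Set (ℝ × ℝ)} (hb : Bornology.IsBounded Ω)
    (hm : MeasurableSet Ω)
    {f : ℝ × ℝ → ℝ} (hf : Continuous f) : MemLp f 2 ((volume : Measure (ℝ × ℝ)).restrict Ω) := by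
  obtain ⟨C, hC⟩ := hb.isCompact_closure.exists_bound_of_continuousOn hf.continuousOn
  have : IsFiniteMeasure ((volume : Measure (ℝ × ℝ)).restrict Ω) :=
    isFiniteMeasure_restrict.2 hb.measure_lt_top.ne
  refine MemLp.of_bound hf.aestronglyMeasurable C ?_
  filter_upwards [ae_restrict_mem hm] with x hx
  exact hC x (subset_closure hx)

lemma continuous_dx {f : ℝ × ℝ → ℝ} (hf : ContDiff ℝ ∞ f) : Continuous (dx f) :=
  (hf.continuous_fderiv (by simp)).clm_apply continuous_const

lemma continuous_dy {f : ℝ × ℝ → ℝ} (hf : ContDiff ℝ ∞ f) : Continuous (dy f) :=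
  (hf.continuous_fderiv (by simp)).clm_apply continuous_const

/-- A smooth function on the plane that vanishes on the boundary of a bounded open set and almost
nowhere inside lies in `H¹₀`. -/
theorem mem_H10_of_eq_zero_on_frontier {Ω : Set (ℝ × ℝ)} (hb : Bornology.IsBounded Ω)
    (ho : IsOpen Ω) {e : ℝ × ℝ → ℝ} (he : ContDiff ℝ ∞ e) (h0 : ∀ p ∈ closure Ω, p ∉ Ω → e p = 0)
    (hne : ∀ᵐ p ∂(volume : Measure (ℝ × ℝ)).restrict Ω, e p ≠ 0) :
    ((memLp_two_of_continuous hb ho.measurableSet he.continuous).toLp e,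
      (memLp_two_of_continuous hb ho.measurableSet (continuous_dx he)).toLp (dx e),
      (memLp_two_of_continuous hb ho.measurableSet (continuous_dy he)).toLp (dy e)) ∈ H10 Ω := by
  have : IsFiniteMeasure ((volume : Measure (ℝ × ℝ)).restrict Ω) :=
    isFiniteMeasure_restrict.2 hb.measure_lt_top.ne
  obtain ⟨T, hT, hT0, hT1, hTle, C, hC⟩ := exists_smooth_truncation
  let c : ℕ → ℝ := fun n => (n : ℝ) + 1
  have hc : ∀ n, 0 < c n := fun n => by positivity
  -- F n vanishes where |e| ≤ 1/c and equals e where |e| > 2/c. The factors c and 1/c cancel in its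
  -- gradient T'(c e) ∇e, which is therefore bounded on Ω uniformly in n. No regularity of the
  -- boundary is needed.
  let F : ℕ → ℝ × ℝ → ℝ := fun n p => (c n)⁻¹ * T (c n * e p)
  have hF : ∀ n, ContDiff ℝ ∞ (F n) := fun n =>
    contDiff_const.mul (hT.comp (contDiff_const.mul he))
  have hed : Differentiable ℝ e := he.differentiable (by simp)
  have hTd : Differentiable ℝ T := hT.differentiable (by simp)
  have hFd : ∀ n p v, fderiv ℝ (F n) p v = deriv T (c n * e p) * fderiv ℝ e p v := by
    intro n p v
    have h1 : HasFDerivAt (fun p => c n * e p) (c n • fderiv ℝ e p) p :=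
      (hed p).hasFDerivAt.const_mul _
    have h2 := ((hTd (c n * e p)).hasDerivAt.comp_hasFDerivAt p h1).const_mul (c n)⁻¹
    have h3 : fderiv ℝ (F n) p = _ := h2.fderiv
    rw [h3]
    simp only [smul_apply, smul_eq_mul]
    field_simp [(hc n).ne']
  have hTc : Continuous (deriv T) := hT.continuous_deriv (by simp)
  let G : (ℝ × ℝ) → ℕ → ℝ × ℝ → ℝ := fun v n p => deriv T (c n * e p) * fderiv ℝ e p v
  have hGc : ∀ v n, Continuous (G v n) := fun v n =>
    (hTc.comp (continuous_const.mul he.continuous)).mul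
      ((he.continuous_fderiv (by simp)).clm_apply continuous_const)
  have hlarge : ∀ p, e p ≠ 0 → ∀ᶠ n in Filter.atTop, 2 < |c n * e p| := by
    intro p hp
    have : Filter.Tendsto (fun n => c n * |e p|) Filter.atTop Filter.atTop :=
      (Filter.tendsto_atTop_add_const_right _ _ tendsto_natCast_atTop_atTop).atTop_mul_const
        (abs_pos.2 hp)
    filter_upwards [this.eventually_gt_atTop 2] with n hn
    rwa [abs_mul, abs_of_pos (hc n)]
  have hconvF : Filter.Tendsto
      (fun n => (memLp_two_of_continuous hb ho.measurableSet (hF n).continuous).toLp (F n))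
      Filter.atTop
      (nhds ((memLp_two_of_continuous hb ho.measurableSet he.continuous).toLp e)) := by
    obtain ⟨B, hB⟩ := hb.isCompact_closure.exists_bound_of_continuousOn he.continuous.continuousOn
    refine tendsto_toLp_two_of_bounded (μ := (volume : Measure (ℝ × ℝ)).restrict Ω) B
      (fun n => memLp_two_of_continuous hb ho.measurableSet (hF n).continuous)
      (memLp_two_of_continuous hb ho.measurableSet he.continuous) (fun n => ?_) ?_ ?_
    · filter_upwards [ae_restrict_mem ho.measurableSet] with p hp
      refine le_trans ?_ (hB p (subset_closure hp))
      simp only [F]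
      rw [abs_mul, abs_of_pos (inv_pos.2 (hc n)), Real.norm_eq_abs, inv_mul_le_iff₀ (hc n)]
      refine (hTle _).trans ?_
      rw [abs_mul, abs_of_pos (hc n)]
    · filter_upwards [ae_restrict_mem ho.measurableSet] with p hp
      exact hB p (subset_closure hp)
    · filter_upwards [hne] with p hp
      refine tendsto_const_nhds.congr' ?_
      filter_upwards [hlarge p hp] with n hn
      simp only [F]
      rw [(hT1 _ hn).1, inv_mul_cancel_left₀ (hc n).ne']
  have hconvG : ∀ (v : ℝ × ℝ) (hcv : Continuous fun p => fderiv ℝ e p v),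
      Filter.Tendsto
        (fun n => (memLp_two_of_continuous hb ho.measurableSet (hGc v n)).toLp (G v n))
        Filter.atTop
        (nhds ((memLp_two_of_continuous hb ho.measurableSet hcv).toLp _)) := by
    intro v hcv
    obtain ⟨B, hB⟩ := hb.isCompact_closure.exists_bound_of_continuousOn hcv.continuousOn
    -- The maximum with 1 makes the same constant bound the limit, which lacks the factor T'; the
    -- maximum with 0 keeps the product monotone.
    refine tendsto_toLp_two_of_bounded (max C 1 * max B 0) _ _ (fun n => ?_) ?_ ?_
    · filter_upwards [ae_restrict_mem ho.measurableSet] with p hp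
      simp only [G, abs_mul]
      exact mul_le_mul ((hC _).trans (le_max_left _ _))
        ((hB p (subset_closure hp)).trans (le_max_left _ _)) (abs_nonneg _) (by positivity)
    · filter_upwards [ae_restrict_mem ho.measurableSet] with p hp
      refine ((hB p (subset_closure hp)).trans (le_max_left _ 0)).trans ?_
      exact le_mul_of_one_le_left (le_max_right _ _) (le_max_right _ _)
    · filter_upwards [hne] with p hp
      refine tendsto_const_nhds.congr' ?_
      filter_upwards [hlarge p hp] with n hn
      simp only [G]
      rw [(hT1 _ hn).2, one_mul]
  refine mem_closure_of_tendsto (hconvF.prodMk_nhds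
    ((hconvG (1, 0) (continuous_dx he)).prodMk_nhds (hconvG (0, 1) (continuous_dy he))))
    (Filter.Eventually.of_forall fun n => ?_)
  -- Since e vanishes on the boundary, K is a compact subset of Ω, and F n is zero on the rest of Ω.
  -- Cutting F n off to zero outside Ω is thus smooth; the cutoff is needed because e may be nonzero
  -- beyond the boundary.
  let K : Set (ℝ × ℝ) := closure Ω ∩ {p | 1 ≤ |c n * e p|}
  have hKcl : IsClosed {p | 1 ≤ |c n * e p|} :=
    isClosed_le continuous_const (continuous_const.mul he.continuous).abs
  have hK : IsCompact K := hb.isCompact_closure.inter_right hKcl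
  have hKΩ : K ⊆ Ω := by
    rintro p ⟨hp, hp1⟩
    by_contra hpΩ
    have : (1 : ℝ) ≤ |c n * e p| := hp1
    rw [h0 p hp hpΩ] at this
    norm_num at this
  have hz : ∀ p, p ∉ K → Ω.indicator (F n) p = 0 := by
    intro p hp
    by_cases hpΩ : p ∈ Ω
    · rw [indicator_of_mem hpΩ]
      have : ¬ (1 ≤ |c n * e p|) := fun h => hp ⟨subset_closure hpΩ, h⟩
      simp [F, hT0 _ (not_le.1 this).le]
    · exact indicator_of_notMem hpΩ _
  have hloc : ∀ p ∈ Ω, Ω.indicator (F n) =ᶠ[nhds p] F n := fun p hp => by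
    filter_upwards [ho.mem_nhds hp] with q hq using indicator_of_mem hq _
  refine ⟨Ω.indicator (F n), ⟨?_, ?_, ?_⟩, ?_, ?_, ?_⟩
  · rw [contDiff_iff_contDiffAt]
    intro p
    by_cases hp : p ∈ Ω
    · exact (hF n).contDiffAt.congr_of_eventuallyEq (hloc p hp)
    · refine (contDiffAt_const (c := (0 : ℝ))).congr_of_eventuallyEq ?_
      filter_upwards [hK.isClosed.isOpen_compl.mem_nhds fun h => hp (hKΩ h)] with q hq
        using hz q hq
  · exact HasCompactSupport.intro hK hz
  · exact (closure_minimal (Function.support_subset_iff'.2 hz) hK.isClosed).trans hKΩ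
  · refine (memLp_two_of_continuous hb ho.measurableSet (hF n).continuous).coeFn_toLp.trans ?_
    filter_upwards [ae_restrict_mem ho.measurableSet] with p hp
    rw [indicator_of_mem hp]
  · refine (memLp_two_of_continuous hb ho.measurableSet (hGc (1, 0) n)).coeFn_toLp.trans ?_
    filter_upwards [ae_restrict_mem ho.measurableSet] with p hp
    rw [dx, (hloc p hp).fderiv_eq, hFd]
  · refine (memLp_two_of_continuous hb ho.measurableSet (hGc (0, 1) n)).coeFn_toLp.trans ?_
    filter_upwards [ae_restrict_mem ho.measurableSet] with p hp
    rw [dy, (hloc p hp).fderiv_eq, hFd]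

/-! ### Integration by parts -/

/-- Integration by parts against a test function. -/
theorem IsTestFunction.setIntegral_mul_fderiv {Ω : Set (ℝ × ℝ)} {f φ : ℝ × ℝ → ℝ}
    (hφ : IsTestFunction Ω φ) (hf : ContDiff ℝ ∞ f) (w : ℝ × ℝ) :
    ∫ p in Ω, f p * fderiv ℝ φ p w = -∫ p in Ω, fderiv ℝ f p w * φ p := by
  have hφd : Continuous fun p => fderiv ℝ φ p w :=
    (hφ.smooth.continuous_fderiv (by simp)).clm_apply continuous_const
  have hfd : Continuous fun p => fderiv ℝ f p w :=
    (hf.continuous_fderiv (by simp)).clm_apply continuous_const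
  have hcs : HasCompactSupport fun p => fderiv ℝ φ p w := hφ.compact.fderiv_apply ℝ _
  have hsupp : ∀ p, p ∉ Ω → φ p = 0 := fun p hp =>
    image_eq_zero_of_notMem_tsupport fun h => hp (hφ.support h)
  have hsupp' : ∀ p, p ∉ Ω → fderiv ℝ φ p = 0 := fun p hp =>
    image_eq_zero_of_notMem_tsupport fun h => hp (hφ.support (tsupport_fderiv_subset ℝ h))
  rw [setIntegral_eq_integral_of_forall_compl_eq_zero (fun p hp => by simp [hsupp' p hp]),
    setIntegral_eq_integral_of_forall_compl_eq_zero (fun p hp => by simp [hsupp p hp])]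
  refine integral_mul_fderiv_eq_neg_fderiv_mul_of_integrable ?_ ?_ ?_ ?_ ?_
  · exact (hfd.mul hφ.smooth.continuous).integrable_of_hasCompactSupport hφ.compact.mul_left
  · exact (hf.continuous.mul hφd).integrable_of_hasCompactSupport hcs.mul_left
  · exact (hf.continuous.mul hφ.smooth.continuous).integrable_of_hasCompactSupport
      hφ.compact.mul_left
  · exact fun p _ => hf.differentiable (by simp) p
  · exact fun p _ => hφ.smooth.differentiable (by simp) p

/-- Integration by parts against `H¹₀`, in the direction of `x`. -/
theorem inner_dx_eq_neg_inner {Ω : Set (ℝ × ℝ)} (hb : Bornology.IsBounded Ω)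
    (hm : MeasurableSet Ω) {f : ℝ × ℝ → ℝ} (hf : ContDiff ℝ ∞ f)
    {v : L2 Ω × L2 Ω × L2 Ω} (hv : v ∈ H10 Ω) :
    inner ℝ ((memLp_two_of_continuous hb hm hf.continuous).toLp f) v.2.1 =
      -inner ℝ ((memLp_two_of_continuous hb hm (continuous_dx hf)).toLp (dx f)) v.1 := by
  -- Both sides are continuous in v, so it suffices to treat test functions, which are dense in H¹₀
  -- by definition.
  have hcl : IsClosed {v : L2 Ω × L2 Ω × L2 Ω |
      inner ℝ ((memLp_two_of_continuous hb hm hf.continuous).toLp f) v.2.1 =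
      -inner ℝ ((memLp_two_of_continuous hb hm (continuous_dx hf)).toLp (dx f)) v.1} :=
    isClosed_eq (by fun_prop) (by fun_prop)
  refine closure_minimal ?_ hcl hv
  rintro ⟨a, a₁, a₂⟩ ⟨φ, hφ, ha, ha₁, -⟩
  simp only [mem_ofPred_eq, L2.inner_def]
  have e1 : ∫ p in Ω, inner ℝ (((memLp_two_of_continuous hb hm hf.continuous).toLp f : L2 Ω) p)
      (a₁ p) = ∫ p in Ω, f p * dx φ p := by
    refine integral_congr_ae ?_
    filter_upwards [(memLp_two_of_continuous hb hm hf.continuous).coeFn_toLp, ha₁] with p h1 h2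
    rw [h1, h2]; simp [mul_comm]
  have e2 : ∫ p in Ω, inner ℝ
      (((memLp_two_of_continuous hb hm (continuous_dx hf)).toLp (dx f) : L2 Ω) p)
      (a p) = ∫ p in Ω, dx f p * φ p := by
    refine integral_congr_ae ?_
    filter_upwards [(memLp_two_of_continuous hb hm (continuous_dx hf)).coeFn_toLp, ha] with p h1 h2
    rw [h1, h2]; simp [mul_comm]
  rw [e1, e2]
  exact hφ.setIntegral_mul_fderiv hf _

/-- Integration by parts against `H¹₀`, in the direction of `y`. -/
theorem inner_dy_eq_neg_inner {Ω : Set (ℝ × ℝ)} (hb : Bornology.IsBounded Ω)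
    (hm : MeasurableSet Ω) {f : ℝ × ℝ → ℝ} (hf : ContDiff ℝ ∞ f)
    {v : L2 Ω × L2 Ω × L2 Ω} (hv : v ∈ H10 Ω) :
    inner ℝ ((memLp_two_of_continuous hb hm hf.continuous).toLp f) v.2.2 =
      -inner ℝ ((memLp_two_of_continuous hb hm (continuous_dy hf)).toLp (dy f)) v.1 := by
  have hcl : IsClosed {v : L2 Ω × L2 Ω × L2 Ω |
      inner ℝ ((memLp_two_of_continuous hb hm hf.continuous).toLp f) v.2.2 =
      -inner ℝ ((memLp_two_of_continuous hb hm (continuous_dy hf)).toLp (dy f)) v.1} :=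
    isClosed_eq (by fun_prop) (by fun_prop)
  refine closure_minimal ?_ hcl hv
  rintro ⟨a, a₁, a₂⟩ ⟨φ, hφ, ha, -, ha₂⟩
  simp only [mem_ofPred_eq, L2.inner_def]
  have e1 : ∫ p in Ω, inner ℝ (((memLp_two_of_continuous hb hm hf.continuous).toLp f : L2 Ω) p)
      (a₂ p) = ∫ p in Ω, f p * dy φ p := by
    refine integral_congr_ae ?_
    filter_upwards [(memLp_two_of_continuous hb hm hf.continuous).coeFn_toLp, ha₂] with p h1 h2
    rw [h1, h2]; simp [mul_comm]
  have e2 : ∫ p in Ω, inner ℝ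
      (((memLp_two_of_continuous hb hm (continuous_dy hf)).toLp (dy f) : L2 Ω) p)
      (a p) = ∫ p in Ω, dy f p * φ p := by
    refine integral_congr_ae ?_
    filter_upwards [(memLp_two_of_continuous hb hm (continuous_dy hf)).coeFn_toLp, ha] with p h1 h2
    rw [h1, h2]; simp [mul_comm]
  rw [e1, e2]
  exact hφ.setIntegral_mul_fderiv hf _

/-! ### The sine modes as orthogonal eigenfunctions -/

lemma isBounded_rectangle (α : ℝ) : Bornology.IsBounded (rectangle α) :=
  (Metric.isBounded_Ioo _ _).prod (Metric.isBounded_Ioo _ _)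

lemma isOpen_rectangle (α : ℝ) : IsOpen (rectangle α) := isOpen_Ioo.prod isOpen_Ioo

lemma measurableSet_rectangle (α : ℝ) : MeasurableSet (rectangle α) :=
  (isOpen_rectangle α).measurableSet

lemma contDiff_sineMode (α : ℝ) (m n : ℕ) : ContDiff ℝ ∞ (sineMode α m n) := by
  unfold sineMode
  fun_prop

lemma contDiff_dx {f : ℝ × ℝ → ℝ} (hf : ContDiff ℝ ∞ f) : ContDiff ℝ ∞ (dx f) :=
  (hf.fderiv_right (by simp)).clm_apply contDiff_const

lemma contDiff_dy {f : ℝ × ℝ → ℝ} (hf : ContDiff ℝ ∞ f) : ContDiff ℝ ∞ (dy f) :=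
  (hf.fderiv_right (by simp)).clm_apply contDiff_const

lemma hasFDerivAt_mul_separated {a b : ℝ → ℝ} {a' b' : ℝ} {p : ℝ × ℝ}
    (ha : HasDerivAt a a' p.1) (hb : HasDerivAt b b' p.2) :
    HasFDerivAt (fun p : ℝ × ℝ => a p.1 * b p.2)
      (a p.1 • b' • ContinuousLinearMap.snd ℝ ℝ ℝ + b p.2 • a' • ContinuousLinearMap.fst ℝ ℝ ℝ)
      p :=
  (ha.comp_hasFDerivAt p hasFDerivAt_fst).mul (hb.comp_hasFDerivAt p hasFDerivAt_snd)

lemma dx_mul_separated {a b : ℝ → ℝ} {a' b' : ℝ} {p : ℝ × ℝ}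
    (ha : HasDerivAt a a' p.1) (hb : HasDerivAt b b' p.2) :
    dx (fun p : ℝ × ℝ => a p.1 * b p.2) p = a' * b p.2 := by
  simp [dx, (hasFDerivAt_mul_separated ha hb).fderiv, mul_comm]

lemma dy_mul_separated {a b : ℝ → ℝ} {a' b' : ℝ} {p : ℝ × ℝ}
    (ha : HasDerivAt a a' p.1) (hb : HasDerivAt b b' p.2) :
    dy (fun p : ℝ × ℝ => a p.1 * b p.2) p = a p.1 * b' := by
  simp [dy, (hasFDerivAt_mul_separated ha hb).fderiv]

lemma hasDerivAt_sin_mul_div (m : ℕ) (α x : ℝ) :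
    HasDerivAt (fun x : ℝ => Real.sin (m * x / α)) (m / α * Real.cos (m * x / α)) x := by
  have h : HasDerivAt (fun x : ℝ => (m : ℝ) * x / α) (m / α) x := by
    simpa using ((hasDerivAt_id x).const_mul (m : ℝ)).div_const α
  simpa [mul_comm] using h.sin

lemma hasDerivAt_cos_mul_div (m : ℕ) (α x : ℝ) :
    HasDerivAt (fun x : ℝ => m / α * Real.cos (m * x / α))
      (-((m : ℝ) / α) ^ 2 * Real.sin (m * x / α)) x := by
  have h : HasDerivAt (fun x : ℝ => (m : ℝ) * x / α) (m / α) x := by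
    simpa using ((hasDerivAt_id x).const_mul (m : ℝ)).div_const α
  exact (h.cos.const_mul ((m : ℝ) / α)).congr_deriv (by ring)

lemma hasDerivAt_sin_mul (n : ℕ) (y : ℝ) :
    HasDerivAt (fun y : ℝ => Real.sin (n * y)) (n * Real.cos (n * y)) y := by
  simpa using hasDerivAt_sin_mul_div n 1 y

lemma hasDerivAt_cos_mul (n : ℕ) (y : ℝ) :
    HasDerivAt (fun y : ℝ => n * Real.cos (n * y)) (-(n : ℝ) ^ 2 * Real.sin (n * y)) y := by
  simpa using hasDerivAt_cos_mul_div n 1 y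

lemma dx_dx_sineMode (α : ℝ) (m n : ℕ) :
    dx (dx (sineMode α m n)) = -(((m : ℝ) / α) ^ 2) • sineMode α m n := by
  have h : dx (sineMode α m n) =
      fun p => (m / α * Real.cos (m * p.1 / α)) * Real.sin (n * p.2) := funext fun p =>
    dx_mul_separated (hasDerivAt_sin_mul_div m α p.1) (hasDerivAt_sin_mul n p.2)
  rw [h]
  funext p
  rw [dx_mul_separated (hasDerivAt_cos_mul_div m α p.1) (hasDerivAt_sin_mul n p.2)]
  simp [sineMode, mul_assoc]

lemma dy_dy_sineMode (α : ℝ) (m n : ℕ) :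
    dy (dy (sineMode α m n)) = -((n : ℝ) ^ 2) • sineMode α m n := by
  have h : dy (sineMode α m n) =
      fun p => Real.sin (m * p.1 / α) * (n * Real.cos (n * p.2)) := funext fun p =>
    dy_mul_separated (hasDerivAt_sin_mul_div m α p.1) (hasDerivAt_sin_mul n p.2)
  rw [h]
  funext p
  rw [dy_mul_separated (hasDerivAt_sin_mul_div m α p.1) (hasDerivAt_cos_mul n p.2)]
  simp only [sineMode, Pi.smul_apply, smul_eq_mul]
  ring

lemma countable_sin_mul_div_eq_zero {α : ℝ} (hα : 0 < α) {m : ℕ} (hm : 0 < m) :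
    {x : ℝ | Real.sin (m * x / α) = 0}.Countable := by
  refine (countable_range fun k : ℤ => k * Real.pi * α / m).mono fun x hx => ?_
  obtain ⟨k, hk⟩ := Real.sin_eq_zero_iff.1 hx
  refine ⟨k, ?_⟩
  have hm' : (m : ℝ) ≠ 0 := by exact_mod_cast hm.ne'
  change k * Real.pi * α / m = x
  rw [hk]
  field_simp

lemma ae_sineMode_ne_zero {α : ℝ} (hα : 0 < α) {m n : ℕ} (hm : 0 < m) (hn : 0 < n) :
    ∀ᵐ p ∂(volume : Measure (ℝ × ℝ)).restrict (rectangle α), sineMode α m n p ≠ 0 := by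
  refine ae_restrict_of_ae ?_
  have h1 : ∀ᵐ x : ℝ, Real.sin (m * x / α) ≠ 0 := by
    have := (countable_sin_mul_div_eq_zero hα hm).ae_notMem volume
    exact this
  have h2 : ∀ᵐ y : ℝ, Real.sin (n * y) ≠ 0 := by
    have := (countable_sin_mul_div_eq_zero one_pos hn).ae_notMem volume
    filter_upwards [this] with y hy
    simpa using hy
  have h1' := (Measure.quasiMeasurePreserving_fst (μ := (volume : Measure ℝ))
    (ν := (volume : Measure ℝ))).ae h1
  have h2' := (Measure.quasiMeasurePreserving_snd (μ := (volume : Measure ℝ))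
    (ν := (volume : Measure ℝ))).ae h2
  rw [← Measure.volume_eq_prod] at h1' h2'
  filter_upwards [h1', h2'] with p hp1 hp2
  exact mul_ne_zero hp1 hp2

lemma closure_rectangle {α : ℝ} (hα : 0 < α) :
    closure (rectangle α) = Icc 0 (α * Real.pi) ×ˢ Icc 0 Real.pi := by
  rw [rectangle, closure_prod_eq, closure_Ioo (mul_pos hα Real.pi_pos).ne,
    closure_Ioo Real.pi_pos.ne]

lemma sineMode_eq_zero_of_mem_closure {α : ℝ} (hα : 0 < α) (m n : ℕ) (p : ℝ × ℝ)
    (hp : p ∈ closure (rectangle α)) (hp' : p ∉ rectangle α) : sineMode α m n p = 0 := by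
  rw [closure_rectangle hα] at hp
  obtain ⟨⟨h1, h2⟩, h3, h4⟩ := hp
  unfold sineMode
  rcases h1.eq_or_lt with h | h1
  · simp [← h]
  rcases h2.eq_or_lt with h | h2
  · have : (m : ℝ) * p.1 / α = m * Real.pi := by rw [h]; field_simp
    simp [this]
  rcases h3.eq_or_lt with h | h3
  · simp [← h]
  rcases h4.eq_or_lt with h | h4
  · simp [h]
  exact absurd ⟨⟨h1, h2⟩, h3, h4⟩ hp'

/-- The `L²` class of a continuous function on the rectangle. -/
def rectangleClass (α : ℝ) {f : ℝ × ℝ → ℝ} (hf : Continuous f) : L2 (rectangle α) :=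
  (memLp_two_of_continuous (isBounded_rectangle α) (measurableSet_rectangle α) hf).toLp f

lemma coeFn_rectangleClass (α : ℝ) {f : ℝ × ℝ → ℝ} (hf : Continuous f) :
    rectangleClass α hf =ᵐ[volume.restrict (rectangle α)] f :=
  MemLp.coeFn_toLp _

/-- The `L²` class of a sine mode. -/
def mode (α : ℝ) (p : ℕ+ × ℕ+) : L2 (rectangle α) :=
  rectangleClass α (contDiff_sineMode α p.1 p.2).continuous

/-- The `L²` class of the gradient of a sine mode. -/
def modeGradient (α : ℝ) (p : ℕ+ × ℕ+) : L2 (rectangle α) × L2 (rectangle α) :=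
  (rectangleClass α (continuous_dx (contDiff_sineMode α p.1 p.2)),
    rectangleClass α (continuous_dy (contDiff_sineMode α p.1 p.2)))

lemma mode_mem_H10 {α : ℝ} (hα : 0 < α) (p : ℕ+ × ℕ+) :
    (mode α p, modeGradient α p) ∈ H10 (rectangle α) :=
  mem_H10_of_eq_zero_on_frontier (isBounded_rectangle α) (isOpen_rectangle α)
    (contDiff_sineMode α p.1 p.2) (sineMode_eq_zero_of_mem_closure hα p.1 p.2)
    (ae_sineMode_ne_zero hα p.1.pos p.2.pos)

lemma rectangleClass_smul (α c : ℝ) {f g : ℝ × ℝ → ℝ} (hf : Continuous f) (hg : Continuous g)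
    (h : g = c • f) : rectangleClass α hg = c • rectangleClass α hf := by
  subst h
  exact MemLp.toLp_const_smul c _

/-- The two directions are kept apart instead of being summed to the eigenvalue equation: this is
what separates distinct modes with the same eigenvalue. -/
lemma inner_modeGradient_fst (α : ℝ) (p : ℕ+ × ℕ+)
    {v : L2 (rectangle α) × L2 (rectangle α) × L2 (rectangle α)} (hv : v ∈ H10 (rectangle α)) :
    inner ℝ (modeGradient α p).1 v.2.1 = (((p.1 : ℕ) : ℝ) / α) ^ 2 * inner ℝ (mode α p) v.1 := by
  have hs := contDiff_sineMode α p.1 p.2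
  have h := inner_dx_eq_neg_inner (isBounded_rectangle α) (measurableSet_rectangle α)
    (contDiff_dx hs) hv
  refine h.trans ?_
  have h' := rectangleClass_smul α _ hs.continuous (continuous_dx (contDiff_dx hs))
    (dx_dx_sineMode α p.1 p.2)
  unfold rectangleClass at h'
  rw [h', real_inner_smul_left, neg_mul, neg_neg]
  rfl

lemma inner_modeGradient_snd (α : ℝ) (p : ℕ+ × ℕ+)
    {v : L2 (rectangle α) × L2 (rectangle α) × L2 (rectangle α)} (hv : v ∈ H10 (rectangle α)) :
    inner ℝ (modeGradient α p).2 v.2.2 = ((p.2 : ℕ) : ℝ) ^ 2 * inner ℝ (mode α p) v.1 := by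
  have hs := contDiff_sineMode α p.1 p.2
  have h := inner_dy_eq_neg_inner (isBounded_rectangle α) (measurableSet_rectangle α)
    (contDiff_dy hs) hv
  refine h.trans ?_
  have h' := rectangleClass_smul α _ hs.continuous (continuous_dy (contDiff_dy hs))
    (dy_dy_sineMode α p.1 p.2)
  unfold rectangleClass at h'
  rw [h', real_inner_smul_left, neg_mul, neg_neg]
  rfl

lemma mode_mem_eigenspace {α : ℝ} (hα : 0 < α) (p : ℕ+ × ℕ+) :
    mode α p ∈ eigenspace (rectangle α) (modeEigenvalue α p.1 p.2) := by
  refine ⟨modeGradient α p, mode_mem_H10 hα p, fun v hv => ?_⟩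
  rw [inner_modeGradient_fst α p hv, inner_modeGradient_snd α p hv]
  change _ = inner ℝ (modeEigenvalue α p.1 p.2 • mode α p) v.1
  rw [real_inner_smul_left, modeEigenvalue, add_mul]

/-- Pairing the x-derivatives of two modes can be evaluated from either side, with factor (p.1/α)²
or (q.1/α)²; likewise in y. A nonzero inner product would force both factors to agree, hence p = q.
No trigonometric integral is computed. -/
lemma inner_mode_eq_zero_of_ne {α : ℝ} (hα : 0 < α) {p q : ℕ+ × ℕ+} (hpq : p ≠ q) :
    inner ℝ (mode α p) (mode α q) = 0 := by
  have h1 := inner_modeGradient_fst α p (mode_mem_H10 hα q)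
  have h1' := inner_modeGradient_fst α q (mode_mem_H10 hα p)
  have h2 := inner_modeGradient_snd α p (mode_mem_H10 hα q)
  have h2' := inner_modeGradient_snd α q (mode_mem_H10 hα p)
  simp only at h1 h1' h2 h2'
  rw [real_inner_comm, real_inner_comm (mode α p)] at h1' h2'
  by_contra hne
  have e1 := mul_right_cancel₀ hne (h1.symm.trans h1')
  have e2 := mul_right_cancel₀ hne (h2.symm.trans h2')
  refine hpq (Prod.ext ?_ ?_)
  · have := (pow_left_inj₀ (by positivity) (by positivity) two_ne_zero).1 e1
    rw [div_left_inj' hα.ne'] at this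
    exact_mod_cast this
  · have := (pow_left_inj₀ (by positivity) (by positivity) two_ne_zero).1 e2
    exact_mod_cast this

lemma mode_ne_zero {α : ℝ} (hα : 0 < α) (p : ℕ+ × ℕ+) : mode α p ≠ 0 := by
  intro h
  have h1 := coeFn_rectangleClass α (contDiff_sineMode α p.1 p.2).continuous
  have h2 : mode α p =ᵐ[volume.restrict (rectangle α)] (0 : ℝ × ℝ → ℝ) := by
    rw [h]; exact Lp.coeFn_zero _ _ _
  have h3 : ∀ᵐ q ∂(volume : Measure (ℝ × ℝ)).restrict (rectangle α), False := by
    filter_upwards [h1, h2, ae_sineMode_ne_zero hα p.1.pos p.2.pos] with q e1 e2 e3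
    exact e3 (e1.symm.trans e2)
  have h4 : (volume : Measure (ℝ × ℝ)).restrict (rectangle α) = 0 := by simpa using h3
  rw [Measure.restrict_eq_zero] at h4
  have hne : (rectangle α).Nonempty :=
    (nonempty_Ioo.2 (mul_pos hα Real.pi_pos)).prod (nonempty_Ioo.2 Real.pi_pos)
  exact ((isOpen_rectangle α).measure_pos volume hne).ne' h4

lemma linearIndependent_mode {α : ℝ} (hα : 0 < α) : LinearIndependent ℝ (mode α) :=
  linearIndependent_of_ne_zero_of_inner_eq_zero (mode_ne_zero hα)
    fun _ _ h => inner_mode_eq_zero_of_ne hα h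

lemma isEigenfunction_sineMode {α : ℝ} (hα : 0 < α) {m n : ℕ} (hm : 0 < m) (hn : 0 < n) :
    IsEigenfunction (rectangle α) (modeEigenvalue α m n) (sineMode α m n) := by
  lift m to ℕ+ using hm
  lift n to ℕ+ using hn
  exact ⟨mode α (m, n), mode_mem_eigenspace hα (m, n), mode_ne_zero hα (m, n),
    coeFn_rectangleClass α _⟩

/-! ### Totality of the sine modes -/

/-- The linear span of the sine modes, as functions on the plane. -/
def sineSpan (α : ℝ) : Submodule ℝ (ℝ × ℝ → ℝ) :=
  Submodule.span ℝ (range fun p : ℕ+ × ℕ+ => sineMode α p.1 p.2)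

/-- Index 0 is allowed because that mode is identically zero; it occurs in the product formula below
when an index is 1. -/
lemma sineMode_mem_sineSpan (α : ℝ) (m n : ℕ) : sineMode α m n ∈ sineSpan α := by
  rcases m.eq_zero_or_pos with rfl | hm
  · have : sineMode α 0 n = 0 := by funext p; simp [sineMode]
    rw [this]; exact Submodule.zero_mem _
  rcases n.eq_zero_or_pos with rfl | hn
  · have : sineMode α m 0 = 0 := by funext p; simp [sineMode]
    rw [this]; exact Submodule.zero_mem _
  lift m to ℕ+ using hm
  lift n to ℕ+ using hn
  exact Submodule.subset_span ⟨(m, n), rfl⟩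

/-- Product-to-sum: 2 cos t sin(jt) = sin((j+1)t) + sin((j-1)t). -/
lemma cos_mul_mem_sineSpan (α : ℝ) {v : ℝ × ℝ → ℝ} (hv : v ∈ sineSpan α) :
    (fun p => Real.cos (p.1 / α) * v p) ∈ sineSpan α ∧
      (fun p => Real.cos p.2 * v p) ∈ sineSpan α := by
  induction hv using Submodule.span_induction with
  | mem v hv =>
    obtain ⟨⟨j, k⟩, rfl⟩ := hv
    obtain ⟨i, hi⟩ : ∃ i : ℕ, (j : ℕ) = i + 1 := ⟨j.natPred, by simp⟩
    obtain ⟨l, hl⟩ : ∃ l : ℕ, (k : ℕ) = l + 1 := ⟨k.natPred, by simp⟩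
    constructor
    · have : (fun p : ℝ × ℝ => Real.cos (p.1 / α) * sineMode α j k p) =
          (1 / 2 : ℝ) • (sineMode α (i + 2) k + sineMode α i k) := by
        funext p
        have e1 : Real.sin (((i + 2 : ℕ) : ℝ) * p.1 / α) =
            Real.sin ((i + 1) * p.1 / α + p.1 / α) := by push_cast; congr 1; ring
        have e2 : Real.sin (((i : ℕ) : ℝ) * p.1 / α) =
            Real.sin ((i + 1) * p.1 / α - p.1 / α) := by congr 1; ring
        simp only [sineMode, Pi.smul_apply, Pi.add_apply, smul_eq_mul]
        rw [e1, e2, Real.sin_add, Real.sin_sub, hi]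
        push_cast
        ring
      exact this ▸ Submodule.smul_mem _ _ (Submodule.add_mem _ (sineMode_mem_sineSpan _ _ _)
        (sineMode_mem_sineSpan _ _ _))
    · have : (fun p : ℝ × ℝ => Real.cos p.2 * sineMode α j k p) =
          (1 / 2 : ℝ) • (sineMode α j (l + 2) + sineMode α j l) := by
        funext p
        have e1 : Real.sin (((l + 2 : ℕ) : ℝ) * p.2) =
            Real.sin ((l + 1) * p.2 + p.2) := by push_cast; congr 1; ring
        have e2 : Real.sin (((l : ℕ) : ℝ) * p.2) =
            Real.sin ((l + 1) * p.2 - p.2) := by congr 1; ring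
        simp only [sineMode, Pi.smul_apply, Pi.add_apply, smul_eq_mul]
        rw [e1, e2, Real.sin_add, Real.sin_sub, hl]
        push_cast
        ring
      exact this ▸ Submodule.smul_mem _ _ (Submodule.add_mem _ (sineMode_mem_sineSpan _ _ _)
        (sineMode_mem_sineSpan _ _ _))
  | zero =>
    have h : (0 : ℝ × ℝ → ℝ) ∈ sineSpan α := Submodule.zero_mem _
    constructor <;> · convert h using 1; funext p; simp
  | add v w _ _ hv hw =>
    refine ⟨?_, ?_⟩
    · convert Submodule.add_mem _ hv.1 hw.1 using 1; funext p; simp [mul_add]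
    · convert Submodule.add_mem _ hv.2 hw.2 using 1; funext p; simp [mul_add]
  | smul c v _ hv =>
    refine ⟨?_, ?_⟩
    · convert Submodule.smul_mem _ c hv.1 using 1; funext p; simp; ring
    · convert Submodule.smul_mem _ c hv.2 using 1; funext p; simp; ring

/-- The continuous functions on `K` that multiply the span of the sine modes into itself. -/
def sineMultipliers (α : ℝ) (K : Set (ℝ × ℝ)) : Subalgebra ℝ C(K, ℝ) where
  carrier := {f | ∀ v ∈ sineSpan α, ∃ w ∈ sineSpan α, ∀ p : K, f p * v p = w p}
  mul_mem' := by
    intro f g hf hg v hv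
    obtain ⟨w, hw, h⟩ := hg v hv
    obtain ⟨z, hz, h'⟩ := hf w hw
    refine ⟨z, hz, fun p => ?_⟩
    rw [← h' p, ← h p, ContinuousMap.mul_apply, mul_assoc]
  add_mem' := by
    intro f g hf hg v hv
    obtain ⟨w, hw, h⟩ := hf v hv
    obtain ⟨z, hz, h'⟩ := hg v hv
    refine ⟨w + z, Submodule.add_mem _ hw hz, fun p => ?_⟩
    rw [Pi.add_apply, ← h' p, ← h p, ContinuousMap.add_apply, add_mul]
  algebraMap_mem' := by
    intro r v hv
    exact ⟨r • v, Submodule.smul_mem _ r hv, fun p => by simp⟩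

/-- cos(x/α) and cos y suffice, since cosine is injective on [0, π]. -/
lemma separatesPoints_sineMultipliers {α : ℝ} (hα : 0 < α) :
    (sineMultipliers α (closure (rectangle α))).SeparatesPoints := by
  rw [closure_rectangle hα]
  rintro ⟨⟨x, y⟩, hx, hy⟩ ⟨⟨x', y'⟩, hx', hy'⟩ hne
  have hmem : ∀ t, t ∈ Icc 0 (α * Real.pi) → t / α ∈ Icc 0 Real.pi := fun t ht =>
    ⟨div_nonneg ht.1 hα.le, by rw [div_le_iff₀ hα, mul_comm]; exact ht.2⟩
  by_cases h : x = x'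
  · have hy2 : y ≠ y' := by
      rintro rfl
      exact hne (by subst h; rfl)
    refine ⟨_, ⟨⟨fun p => Real.cos p.1.2, by fun_prop⟩, ?_, rfl⟩, ?_⟩
    · exact fun v hv => ⟨_, (cos_mul_mem_sineSpan α hv).2, fun p => rfl⟩
    · exact fun h' => hy2 (Real.injOn_cos hy hy' h')
  · refine ⟨_, ⟨⟨fun p => Real.cos (p.1.1 / α), by fun_prop⟩, ?_, rfl⟩, ?_⟩
    · exact fun v hv => ⟨_, (cos_mul_mem_sineSpan α hv).1, fun p => rfl⟩
    · intro h'
      have := Real.injOn_cos (hmem x hx) (hmem x' hx') h'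
      exact h ((div_left_inj' hα.ne').1 this)

/-- The sine modes are total in `L²` of the rectangle. -/
theorem eq_zero_of_inner_mode_eq_zero {α : ℝ} (hα : 0 < α) (u : L2 (rectangle α))
    (hu : ∀ p, inner ℝ (mode α p) u = 0) : u = 0 := by
  set μ := (volume : Measure (ℝ × ℝ)).restrict (rectangle α) with hμ
  have hcpt : IsCompact (closure (rectangle α)) := (isBounded_rectangle α).isCompact_closure
  have : CompactSpace (closure (rectangle α)) := isCompact_iff_compactSpace.1 hcpt
  have hfin : IsFiniteMeasure μ :=
    isFiniteMeasure_restrict.2 (isBounded_rectangle α).measure_lt_top.ne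
  have hint : ∀ h : ℝ × ℝ → ℝ, Continuous h → Integrable (fun p => h p * u p) μ := fun h hh =>
    (memLp_two_of_continuous (isBounded_rectangle α) (measurableSet_rectangle α) hh).integrable_mul
      (Lp.memLp u)
  have huint : Integrable (fun p => u p) μ := by simpa using hint (fun _ => 1) continuous_const
  have hV : ∀ h ∈ sineSpan α, Continuous h ∧ ∫ p, h p * u p ∂μ = 0 := by
    intro h hh
    induction hh using Submodule.span_induction with
    | mem v hv =>
      obtain ⟨q, rfl⟩ := hv
      refine ⟨(contDiff_sineMode α q.1 q.2).continuous, ?_⟩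
      rw [← hu q, L2.inner_def]
      refine integral_congr_ae ?_
      filter_upwards [coeFn_rectangleClass α (contDiff_sineMode α q.1 q.2).continuous] with p hp
      rw [mode, hp]
      simp [mul_comm]
    | zero => exact ⟨continuous_zero, by simp⟩
    | add v w _ _ hv hw =>
      refine ⟨hv.1.add hw.1, ?_⟩
      simp only [Pi.add_apply, add_mul]
      rw [integral_add (hint v hv.1) (hint w hw.1), hv.2, hw.2, add_zero]
    | smul c v _ hv =>
      refine ⟨hv.1.const_smul c, ?_⟩
      simp only [Pi.smul_apply, smul_eq_mul, mul_assoc]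
      rw [integral_const_mul, hv.2, mul_zero]
  have he := (contDiff_sineMode α 1 1).continuous
  have hle : ∀ p, |sineMode α 1 1 p| ≤ 1 := fun p => by
    rw [sineMode, abs_mul]
    exact mul_le_one₀ (Real.abs_sin_le_one _) (abs_nonneg _) (Real.abs_sin_le_one _)
  -- Approximate g uniformly by a multiplier P. The product of P with the first mode lies in the
  -- span, to which u is orthogonal, so only the error, at most ε ∫ |u|, remains.
  have hg0 : ∀ g : ℝ × ℝ → ℝ, Continuous g → ∫ p, g p * (sineMode α 1 1 p * u p) ∂μ = 0 := by
    intro g hg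
    have hsmall : ∀ ε : ℝ, 0 < ε →
        |∫ p, g p * (sineMode α 1 1 p * u p) ∂μ| ≤ ε * ∫ p, |u p| ∂μ := by
      intro ε hε
      obtain ⟨⟨P, hP⟩, hPg⟩ :=
        ContinuousMap.exists_mem_subalgebra_near_continuousMap_of_separatesPoints
          (sineMultipliers α (closure (rectangle α))) (separatesPoints_sineMultipliers hα)
          ⟨fun p => g p, by fun_prop⟩ ε hε
      obtain ⟨w, hw, hPw⟩ := hP _ (sineMode_mem_sineSpan α 1 1)
      obtain ⟨hwc, hw0⟩ := hV w hw
      have hgi : Integrable (fun p => g p * (sineMode α 1 1 p * u p)) μ := by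
        simpa [mul_assoc] using hint _ (hg.mul he)
      have hsub : ∫ p, g p * (sineMode α 1 1 p * u p) ∂μ =
          ∫ p, (g p * (sineMode α 1 1 p * u p) - w p * u p) ∂μ := by
        rw [integral_sub hgi (hint w hwc), hw0, sub_zero]
      rw [hsub, ← integral_const_mul, ← Real.norm_eq_abs]
      refine norm_integral_le_of_norm_le (huint.abs.const_mul ε) ?_
      filter_upwards [ae_restrict_mem (measurableSet_rectangle α)] with p hp
      have hpw := hPw ⟨p, subset_closure hp⟩
      have hb := (ContinuousMap.norm_coe_le_norm _ (⟨p, subset_closure hp⟩ :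
        closure (rectangle α))).trans hPg.le
      have hb' : |P ⟨p, subset_closure hp⟩ - g p| ≤ ε := hb
      have : g p * (sineMode α 1 1 p * u p) - w p * u p =
          -(P ⟨p, subset_closure hp⟩ - g p) * sineMode α 1 1 p * u p := by
        rw [← hpw]; ring
      rw [this, Real.norm_eq_abs, abs_mul, abs_mul, abs_neg]
      gcongr
      exact (mul_le_of_le_one_right (abs_nonneg _) (hle p)).trans hb'
    have hlim : Filter.Tendsto (fun ε : ℝ => ε * ∫ p, |u p| ∂μ) (nhdsWithin 0 (Ioi 0)) (nhds 0) := by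
      have : Filter.Tendsto (fun ε : ℝ => ε * ∫ p, |u p| ∂μ) (nhds 0) (nhds (0 * _)) :=
        Filter.tendsto_id.mul_const _
      rw [zero_mul] at this
      exact this.mono_left nhdsWithin_le_nhds
    have := ge_of_tendsto hlim (Filter.eventually_of_mem self_mem_nhdsWithin hsmall)
    exact abs_nonpos_iff.1 this
  have hloc : LocallyIntegrableOn (fun p => sineMode α 1 1 p * u p) (rectangle α) μ :=
    (hint _ he).locallyIntegrable.locallyIntegrableOn _
  -- By the fundamental lemma of the calculus of variations the first mode times u vanishes a.e.;
  -- the mode itself is nonzero a.e., so u = 0.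
  have hae := (isOpen_rectangle α).ae_eq_zero_of_integral_contDiff_smul_eq_zero hloc
    fun g hg _ _ => hg0 g hg.continuous
  rw [Lp.eq_zero_iff_ae_eq_zero]
  filter_upwards [hae, ae_restrict_mem (measurableSet_rectangle α),
    ae_sineMode_ne_zero hα one_pos one_pos] with p h1 h2 h3
  exact (mul_eq_zero.1 (h1 h2)).resolve_left h3

/-! ### Eigenspaces and multiplicities -/

/-- Symmetry of the form: the pairing of the two gradients equals both μ and the eigenvalue of the
mode times the same inner product. -/
lemma inner_mode_eq_zero_of_mem_eigenspace {α : ℝ} (hα : 0 < α) {μ : ℝ} {u : L2 (rectangle α)}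
    (hu : u ∈ eigenspace (rectangle α) μ) {p : ℕ+ × ℕ+} (hp : modeEigenvalue α p.1 p.2 ≠ μ) :
    inner ℝ (mode α p) u = 0 := by
  obtain ⟨g, hg, h⟩ := hu
  have h1 := h _ (mode_mem_H10 hα p)
  have h2 := inner_modeGradient_fst α p hg
  have h3 := inner_modeGradient_snd α p hg
  change inner ℝ g.1 (modeGradient α p).1 + inner ℝ g.2 (modeGradient α p).2 =
    inner ℝ (μ • u) (mode α p) at h1
  change inner ℝ (modeGradient α p).1 g.1 = _ * inner ℝ (mode α p) u at h2
  change inner ℝ (modeGradient α p).2 g.2 = _ * inner ℝ (mode α p) u at h3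
  rw [real_inner_comm, h2, real_inner_comm _ g.2, h3, real_inner_smul_left,
    real_inner_comm _ u, ← add_mul] at h1
  by_contra hne
  exact hp (mul_right_cancel₀ hne h1)

/-- The eigenspaces of the Dirichlet Laplacian of the rectangle are spanned by sine modes. -/
theorem eigenspace_rectangle {α : ℝ} (hα : 0 < α) {μ : ℝ}
    (hfin : {p : ℕ+ × ℕ+ | modeEigenvalue α p.1 p.2 = μ}.Finite) :
    eigenspace (rectangle α) μ =
      Submodule.span ℝ (mode α '' {p : ℕ+ × ℕ+ | modeEigenvalue α p.1 p.2 = μ}) := by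
  set S := {p : ℕ+ × ℕ+ | modeEigenvalue α p.1 p.2 = μ} with hS
  set W := Submodule.span ℝ (mode α '' S) with hW
  have hle : W ≤ eigenspace (rectangle α) μ := by
    rw [hW, Submodule.span_le]
    rintro _ ⟨p, hp, rfl⟩
    have hp : modeEigenvalue α p.1 p.2 = μ := hp
    exact hp ▸ mode_mem_eigenspace hα p
  refine le_antisymm (fun u hu => ?_) hle
  have : FiniteDimensional ℝ W := FiniteDimensional.span_of_finite ℝ (hfin.image _)
  have hmem : W.starProjection u ∈ W :=
    W.starProjection_apply_mem u
  -- The remainder is orthogonal to the modes in W by projection. It is still an eigenvector for μ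
  -- or zero, so it is orthogonal to all other modes too, and totality applies.
  have h0 : u - W.starProjection u = 0 := by
    refine eq_zero_of_inner_mode_eq_zero hα _ fun p => ?_
    by_cases hp : modeEigenvalue α p.1 p.2 = μ
    · exact W.sub_starProjection_mem_orthogonal u (mode α p)
        (Submodule.subset_span ⟨p, hp, rfl⟩)
    · exact inner_mode_eq_zero_of_mem_eigenspace hα (Submodule.sub_mem _ hu (hle hmem)) hp
  rw [sub_eq_zero.1 h0]
  exact hmem

theorem toENat_rank_eigenspace_rectangle {α : ℝ} (hα : 0 < α) {μ : ℝ}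
    (hfin : {p : ℕ+ × ℕ+ | modeEigenvalue α p.1 p.2 = μ}.Finite) :
    Cardinal.toENat (Module.rank ℝ (eigenspace (rectangle α) μ)) =
      {p : ℕ+ × ℕ+ | modeEigenvalue α p.1 p.2 = μ}.encard := by
  have hli := linearIndependent_mode hα
  rw [eigenspace_rectangle hα hfin, rank_span_set (hli.linearIndepOn_id.mono (image_subset_range _ _)),
    ← hli.injective.encard_image]
  rfl

/-! ### Counting values and listing them in increasing order -/

lemma modeEigenvalue_lt_iff {α : ℝ} (p : ℕ+ × ℕ+) (μ : ℝ) :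
    (((p.1 : ℕ) : ℝ), ((p.2 : ℕ) : ℝ)) ∈ quarterEllipse α μ ↔ modeEigenvalue α p.1 p.2 < μ := by
  have h1 : (0 : ℝ) < ((p.1 : ℕ) : ℝ) := by exact_mod_cast p.1.pos
  have h2 : (0 : ℝ) < ((p.2 : ℕ) : ℝ) := by exact_mod_cast p.2.pos
  simp [quarterEllipse, modeEigenvalue, h1, h2]

lemma finite_modeEigenvalue_le {α : ℝ} (hα : 0 < α) (c : ℝ) :
    {p : ℕ+ × ℕ+ | modeEigenvalue α p.1 p.2 ≤ c}.Finite := by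
  -- A number t > 1 + |c| has t² > c, so both j/α and k are at most 1 + |c|.
  obtain ⟨N, hN⟩ := exists_nat_gt (max (α * (1 + |c|)) (1 + |c|))
  have hN1 := (le_max_left _ _).trans_lt hN
  have hN2 := (le_max_right _ _).trans_lt hN
  have hNpos : 0 < N := by
    have : (0 : ℝ) < N := lt_trans (by positivity) hN2
    exact_mod_cast this
  obtain ⟨K, hK⟩ : ∃ K : ℕ+, (K : ℕ) = N := ⟨⟨N, hNpos⟩, rfl⟩
  refine ((finite_Iic K).prod (finite_Iic K)).subset fun p h => ?_
  obtain ⟨i, j⟩ : ℕ+ × ℕ+ := p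
  have h : (((i : ℕ) : ℝ) / α) ^ 2 + ((j : ℕ) : ℝ) ^ 2 ≤ c := h
  have hc : c ≤ |c| := le_abs_self c
  constructor
  · change i ≤ K
    rw [← PNat.coe_le_coe, hK]
    have h1 : ((i : ℕ) : ℝ) / α ≤ 1 + |c| := by
      by_contra! hlt
      nlinarith [abs_nonneg c, sq_nonneg ((j : ℕ) : ℝ)]
    rw [div_le_iff₀ hα] at h1
    have : ((i : ℕ) : ℝ) ≤ N := by linarith
    exact_mod_cast this
  · change j ≤ K
    rw [← PNat.coe_le_coe, hK]
    have h1 : ((j : ℕ) : ℝ) ≤ 1 + |c| := by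
      by_contra! hlt
      nlinarith [abs_nonneg c, sq_nonneg (((i : ℕ) : ℝ) / α)]
    have : ((j : ℕ) : ℝ) ≤ N := by linarith
    exact_mod_cast this

/-- Two functions whose fibres have the same finite cardinalities have preimages of the same
cardinality. -/
lemma encard_preimage_eq_of_encard_fiber_eq {A B : Type*} {f : A → ℝ} {g : B → ℝ}
    (hfin : ∀ μ, {b | g b = μ}.Finite)
    (h : ∀ μ, {a | f a = μ}.encard = {b | g b = μ}.encard) (S : Set ℝ) :
    {a | f a ∈ S}.encard = {b | g b ∈ S}.encard := by
  have heq : ∀ μ, Nonempty ({a // f a = μ} ≃ {b // g b = μ}) := by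
    intro μ
    have hf : {a | f a = μ}.Finite := by
      rw [← encard_lt_top_iff, h μ]; exact (hfin μ).encard_lt_top
    have : Finite {a // f a = μ} := hf
    have : Finite {b // g b = μ} := hfin μ
    refine Finite.card_eq.1 ?_
    have := congrArg ENat.toNat (h μ)
    exact this
  have e : ∀ μ, {a // f a = μ} ≃ {b // g b = μ} := fun μ => (heq μ).some
  -- The bijections between fibres glue to a bijection of A with B that carries f to g.
  let E : A ≃ B := (Equiv.sigmaFiberEquiv f).symm.trans
    ((Equiv.sigmaCongrRight e).trans (Equiv.sigmaFiberEquiv g))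
  have hE : ∀ a, g (E a) = f a := fun a => (e (f a) ⟨a, rfl⟩).2
  have : {b | g b ∈ S} = E '' {a | f a ∈ S} := by
    ext b
    constructor
    · intro hb
      refine ⟨E.symm b, ?_, E.apply_symm_apply b⟩
      simpa [← hE] using hb
    · rintro ⟨a, ha, rfl⟩
      simpa [hE] using ha
  rw [this, E.injective.encard_image]

/-- An initial segment of the positive integers with `N` elements is `{1, …, N}`. -/
lemma mem_iff_le_of_encard_eq {S : Set ℕ+} (hS : IsLowerSet S) {N : ℕ}
    (hN : S.encard = N) (k : ℕ+) : k ∈ S ↔ (k : ℕ) ≤ N := by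
  have hfin : S.Finite := finite_of_encard_eq_coe hN
  have hIic : ∀ k : ℕ+, (Iic k).encard = ((k : ℕ) : ℕ∞) := by
    intro k
    rw [← Finset.coe_Iic, encard_coe_eq_coe_finsetCard]
    congr 1
    have : (Finset.Icc 1 k).card = k + 1 - 1 := PNat.card_Icc 1 k
    rw [show (Finset.Iic k) = Finset.Icc 1 k by ext; simp, this]
    simp
  constructor
  · intro hk
    have hsub : Iic k ⊆ S := fun j hj => hS hj hk
    have := encard_le_encard hsub
    rw [hIic, hN] at this
    exact_mod_cast this
  · intro hk
    by_contra hkS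
    have hsub : S ⊂ Iic k := by
      refine ⟨fun j hj => ?_, fun hsup => hkS (hsup (mem_Iic.2 le_rfl))⟩
      by_contra hjk
      exact hkS (hS (not_le.1 hjk).le hj)
    have := hfin.encard_lt_encard hsub
    rw [hIic, hN] at this
    exact absurd hk (not_le.2 (by exact_mod_cast this))

/-- A family of reals with finite sublevel sets over an infinite index set can be listed in
increasing order. -/
lemma exists_monotone_encard_fiber_eq {B : Type*} [Infinite B] {g : B → ℝ}
    (hfin : ∀ c, {b | g b ≤ c}.Finite) :
    ∃ lam : ℕ+ → ℝ, Monotone lam ∧ ∀ μ, {k | lam k = μ}.encard = {b | g b = μ}.encard := by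
  have hex : ∀ k : ℕ+, ∃ b, (k : ℕ) ≤ {b' | g b' ≤ g b}.ncard := by
    intro k
    obtain ⟨s, hs⟩ := Infinite.exists_subset_card_eq B (k : ℕ)
    have hne : s.Nonempty := by rw [← Finset.card_pos, hs]; exact k.pos
    obtain ⟨b, -, hb⟩ := s.exists_max_image g hne
    refine ⟨b, ?_⟩
    rw [← hs, ← ncard_coe_finset]
    exact ncard_le_ncard (fun x hx => hb x hx) (hfin _)
  -- The k-th term is the least value of g whose sublevel set has at least k elements. Finite
  -- sublevel sets make the minimum attained.
  have hmin : ∀ k : ℕ+, ∃ b, (k : ℕ) ≤ {b' | g b' ≤ g b}.ncard ∧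
      ∀ c, (k : ℕ) ≤ {b' | g b' ≤ g c}.ncard → g b ≤ g c := by
    intro k
    obtain ⟨b₀, hb₀⟩ := hex k
    have hf : {b | g b ≤ g b₀ ∧ (k : ℕ) ≤ {b' | g b' ≤ g b}.ncard}.Finite :=
      (hfin (g b₀)).subset fun b hb => hb.1
    obtain ⟨b, hb, hbm⟩ := Set.exists_min_image _ g hf ⟨b₀, le_rfl, hb₀⟩
    refine ⟨b, hb.2, fun c hc => ?_⟩
    by_cases hcb : g c ≤ g b₀
    · exact hbm c ⟨hcb, hc⟩
    · exact hb.1.trans (not_le.1 hcb).le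
  choose β hβ hβmin using hmin
  have hle : ∀ k c, g (β k) ≤ c ↔ (k : ℕ) ≤ {b | g b ≤ c}.ncard := by
    intro k c
    constructor
    · intro h
      exact (hβ k).trans (ncard_le_ncard (fun x (hx : g x ≤ _) => hx.trans h) (hfin c))
    · intro h
      have hne : {b | g b ≤ c}.Nonempty := by
        rw [← ncard_pos (hfin c)]; exact k.pos.trans_le h
      obtain ⟨b, hb, hbm⟩ := Set.exists_max_image _ g (hfin c) hne
      refine (hβmin k b (h.trans (ncard_le_ncard (fun x hx => hbm x hx) (hfin _)))).trans hb
  have hmono : Monotone fun k => g (β k) := fun k l hkl =>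
    (hle k _).2 (le_trans (by exact_mod_cast hkl) (hβ l))
  refine ⟨fun k => g (β k), hmono, fun μ => ?_⟩
  have hfinlt : {b | g b < μ}.Finite := (hfin μ).subset fun b (hb : g b < μ) => hb.le
  have hlt : ∀ k, g (β k) < μ ↔ (k : ℕ) ≤ {b | g b < μ}.ncard := by
    intro k
    constructor
    · intro h
      exact ((hle k _).1 le_rfl).trans
        (ncard_le_ncard (fun x (hx : g x ≤ _) => lt_of_le_of_lt hx h) hfinlt)
    · intro h
      have hne : {b | g b < μ}.Nonempty := by
        rw [← ncard_pos hfinlt]; exact k.pos.trans_le h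
      obtain ⟨b, hb, hbm⟩ := Set.exists_max_image _ g hfinlt hne
      exact lt_of_le_of_lt
        (hβmin k b (h.trans (ncard_le_ncard (fun x hx => hbm x hx) (hfin _)))) hb
  -- The term equals μ exactly when #{g < μ} < k ≤ #{g ≤ μ}.
  have hset : {k : ℕ+ | g (β k) = μ} =
      (fun k : ℕ+ => (k : ℕ)) ⁻¹' Ioc {b | g b < μ}.ncard {b | g b ≤ μ}.ncard := by
    ext k
    simp only [mem_ofPred_eq, mem_preimage, mem_Ioc]
    rw [← hle, ← not_le, ← hlt, not_lt, le_antisymm_iff, and_comm]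
  have himg : (fun k : ℕ+ => (k : ℕ)) '' {k : ℕ+ | g (β k) = μ} =
      Ioc {b | g b < μ}.ncard {b | g b ≤ μ}.ncard := by
    rw [hset, image_preimage_eq_of_subset]
    rintro n ⟨hn, -⟩
    exact ⟨⟨n, (Nat.zero_le _).trans_lt hn⟩, rfl⟩
  rw [← PNat.coe_injective.encard_image, himg]
  have hsub : {b | g b < μ} ⊆ {b | g b ≤ μ} := fun b (hb : g b < μ) => hb.le
  have hd : {b | g b = μ} = {b | g b ≤ μ} \ {b | g b < μ} := by
    ext b; simp [le_antisymm_iff]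
  rw [← Finset.coe_Ioc, encard_coe_eq_coe_finsetCard, Nat.card_Ioc, ← ncard_sdiff hsub hfinlt, ← hd,
    ((hfin μ).subset fun b (hb : g b = μ) => hb.le : {b | g b = μ}.Finite).cast_ncard_eq]

/-- A nondecreasing sequence is determined by the finite cardinalities of its fibres, once its
sublevel sets are finite. -/
lemma eq_of_monotone_of_encard_fiber_eq {B : Type*} {g : B → ℝ} (hfin : ∀ c, {b | g b ≤ c}.Finite)
    {lam lam' : ℕ+ → ℝ} (hm : Monotone lam) (hm' : Monotone lam')
    (h : ∀ μ, {k | lam k = μ}.encard = {b | g b = μ}.encard)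
    (h' : ∀ μ, {k | lam' k = μ}.encard = {b | g b = μ}.encard) : lam' = lam := by
  have hfib : ∀ μ, {b | g b = μ}.Finite := fun μ =>
    (hfin μ).subset fun b (hb : g b = μ) => hb.le
  -- The counting function of g alone decides when lam k ≤ c, so it determines lam.
  have key : ∀ lam : ℕ+ → ℝ, Monotone lam →
      (∀ μ, {k | lam k = μ}.encard = {b | g b = μ}.encard) →
      ∀ c k, lam k ≤ c ↔ (k : ℕ) ≤ {b | g b ≤ c}.ncard := by
    intro lam hm h c k
    refine mem_iff_le_of_encard_eq (S := {k | lam k ≤ c})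
      (fun a b hab ha => (hm hab).trans ha) ?_ k
    rw [(hfin c).cast_ncard_eq]
    exact encard_preimage_eq_of_encard_fiber_eq hfib h (Iic c)
  funext k
  apply le_antisymm
  · rw [key lam' hm' h', ← key lam hm h]
  · rw [key lam hm h, ← key lam' hm' h']

/-- The first index of an eigenvalue is one more than the number of smaller eigenvalues. -/
lemma firstIndex_eq {B : Type*} {g : B → ℝ} (hfin : ∀ c, {b | g b ≤ c}.Finite)
    {lam : ℕ+ → ℝ} (hm : Monotone lam)
    (h : ∀ μ, {k | lam k = μ}.encard = {b | g b = μ}.encard) (b₀ : B) :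
    (∃ k, lam k = g b₀) ∧ firstIndex lam (g b₀) = {b | g b < g b₀}.ncard + 1 := by
  have hfib : ∀ μ, {b | g b = μ}.Finite := fun μ =>
    (hfin μ).subset fun b (hb : g b = μ) => hb.le
  have hfinlt : {b | g b < g b₀}.Finite := (hfin _).subset fun b (hb : g b < _) => hb.le
  have hk : ∃ k, lam k = g b₀ := by
    have : {k | lam k = g b₀}.encard ≠ 0 := by
      rw [h, encard_ne_zero]; exact ⟨b₀, rfl⟩
    exact encard_ne_zero.1 this
  refine ⟨hk, ?_⟩
  have hlt : ∀ k, lam k < g b₀ ↔ (k : ℕ) ≤ {b | g b < g b₀}.ncard := by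
    intro k
    refine mem_iff_le_of_encard_eq (S := {k | lam k < g b₀})
      (fun a b hab ha => (hm hab).trans_lt ha) ?_ k
    rw [hfinlt.cast_ncard_eq]
    exact encard_preimage_eq_of_encard_fiber_eq hfib h (Iio (g b₀))
  obtain ⟨k, hk⟩ := hk
  have hpos : 0 < {b | g b < g b₀}.ncard + 1 := Nat.succ_pos _
  obtain ⟨K, hK⟩ : ∃ K : ℕ+, (K : ℕ) = {b | g b < g b₀}.ncard + 1 := ⟨⟨_, hpos⟩, rfl⟩
  have hlamK : lam K = g b₀ := by
    apply le_antisymm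
    · have hKk : K ≤ k := by
        rw [← PNat.coe_le_coe, hK, Nat.succ_le_iff, ← not_le, ← hlt, hk]
        exact lt_irrefl _
      exact (hm hKk).trans hk.le
    · rw [← not_lt, hlt, hK]
      omega
  refine IsLeast.csInf_eq ⟨?_, ?_⟩
  · rw [← hK]
    exact ⟨K.pos, hlamK⟩
  · rintro j ⟨hj, hj'⟩
    by_contra! hlt'
    have := (hlt ⟨j, hj⟩).2 (Nat.lt_succ_iff.1 hlt')
    exact absurd hj' this.ne

/-! ### Lattice points in the quarter ellipse -/

lemma latticePoints_diff_eq (α μ : ℝ) (m n : ℕ) :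
    latticePoints (quarterEllipse α μ \ indexRectangle m n) =
      (fun p : ℕ+ × ℕ+ => (((p.1 : ℕ) : ℤ), ((p.2 : ℕ) : ℤ))) ''
        ({p | modeEigenvalue α p.1 p.2 < μ} \ {p | (p.1 : ℕ) ≤ m ∧ (p.2 : ℕ) ≤ n}) := by
  have hrect : ∀ p : ℕ+ × ℕ+, (((p.1 : ℕ) : ℝ), ((p.2 : ℕ) : ℝ)) ∈ indexRectangle m n ↔
      ((p.1 : ℕ) ≤ m ∧ (p.2 : ℕ) ≤ n) := by
    intro p
    simp [indexRectangle]
  ext ⟨i, j⟩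
  constructor
  · intro h
    have hi : (0 : ℤ) < i := by
      have h1 : (0 : ℝ) < i := h.1.1
      exact_mod_cast h1
    have hj : (0 : ℤ) < j := by
      have h1 : (0 : ℝ) < j := h.1.2.1
      exact_mod_cast h1
    lift i to ℕ using hi.le
    lift j to ℕ using hj.le
    refine ⟨(⟨i, by exact_mod_cast hi⟩, ⟨j, by exact_mod_cast hj⟩), ⟨?_, ?_⟩, rfl⟩
    · exact (modeEigenvalue_lt_iff _ μ).1 h.1
    · exact fun h' => h.2 ((hrect (⟨i, by exact_mod_cast hi⟩, ⟨j, by exact_mod_cast hj⟩)).2 h')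
  · rintro ⟨p, ⟨h1, h2⟩, h⟩
    obtain ⟨rfl, rfl⟩ := Prod.mk.inj h
    exact ⟨(modeEigenvalue_lt_iff p μ).2 h1, fun h' => h2 ((hrect p).1 h')⟩

/-- The number of modes below the mode `(m, n)`, counted inside and outside the rectangle of
indices. -/
lemma ncard_modeEigenvalue_lt {α : ℝ} (hα : 0 < α) {m n : ℕ} (hm : 0 < m) (hn : 0 < n) :
    (latticePoints (quarterEllipse α (modeEigenvalue α m n) \ indexRectangle m n)).Finite ∧
    {p : ℕ+ × ℕ+ | modeEigenvalue α p.1 p.2 < modeEigenvalue α m n}.ncard + 1 = m * n +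
      (latticePoints (quarterEllipse α (modeEigenvalue α m n) \ indexRectangle m n)).ncard := by
  lift m to ℕ+ using hm
  lift n to ℕ+ using hn
  set S := {p : ℕ+ × ℕ+ | modeEigenvalue α p.1 p.2 < modeEigenvalue α m n} with hS
  set R := {p : ℕ+ × ℕ+ | (p.1 : ℕ) ≤ m ∧ (p.2 : ℕ) ≤ n} with hR
  have hSfin : S.Finite := by
    refine (finite_modeEigenvalue_le hα (modeEigenvalue α m n)).subset fun p hp => ?_
    exact (show modeEigenvalue α p.1 p.2 < modeEigenvalue α m n from hp).le
  have hinj : Function.Injective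
      (fun p : ℕ+ × ℕ+ => (((p.1 : ℕ) : ℤ), ((p.2 : ℕ) : ℤ))) := by
    rintro ⟨a, b⟩ ⟨c, d⟩ h
    simpa using h
  have hReq : R = Iic m ×ˢ Iic n := by
    ext ⟨a, b⟩
    simp only [hR, mem_ofPred_eq, PNat.coe_le_coe, mem_prod, mem_Iic]
  have hIic : ∀ k : ℕ+, (Iic k).ncard = k := by
    intro k
    rw [← Finset.coe_Iic, ncard_coe_finset, show (Finset.Iic k) = Finset.Icc 1 k by ext; simp,
      PNat.card_Icc]
    simp
  have hRcard : R.ncard = m * n := by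
    rw [hReq, ncard_prod, hIic, hIic]
  have hRfin : R.Finite := by rw [hReq]; exact (finite_Iic _).prod (finite_Iic _)
  have hmem : (m, n) ∈ R := ⟨le_rfl, le_rfl⟩
  -- The value increases strictly in each index, so in the index rectangle only the corner fails to
  -- lie strictly below. The lost corner is offset by the + 1 of the first index.
  have hinter : S ∩ R = R \ {(m, n)} := by
    ext ⟨a, b⟩
    simp only [mem_inter_iff, mem_sdiff, mem_singleton_iff, Prod.mk.injEq, ← PNat.coe_inj]
    rw [and_comm]
    refine and_congr_right fun hab => ?_
    have h1 : (a : ℕ) ≤ m := hab.1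
    have h2 : (b : ℕ) ≤ n := hab.2
    constructor
    · rintro h ⟨ha, hb⟩
      have h : modeEigenvalue α (a : ℕ) (b : ℕ) < modeEigenvalue α m n := h
      rw [ha, hb] at h
      exact lt_irrefl _ h
    · intro h
      change modeEigenvalue α (a : ℕ) (b : ℕ) < modeEigenvalue α m n
      unfold modeEigenvalue
      rcases h1.lt_or_eq with h3 | h3
      · refine add_lt_add_of_lt_of_le ?_ ?_
        · gcongr
        · gcongr
      · have h4 : (b : ℕ) < n := lt_of_le_of_ne h2 fun h4 => h ⟨h3, h4⟩
        refine add_lt_add_of_le_of_lt ?_ ?_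
        · gcongr
        · gcongr
  have h1 := ncard_inter_add_ncard_sdiff_eq_ncard S R hSfin
  have h2 := ncard_sdiff_singleton_add_one hmem hRfin
  rw [latticePoints_diff_eq, ncard_image_of_injective _ hinj]
  refine ⟨(hSfin.subset sdiff_subset).image _, ?_⟩
  rw [hinter] at h1
  change S.ncard + 1 = m * n + (S \ R).ncard
  omega

/-! ### Nodal domains -/

/-- If a continuous map to a discrete space has preconnected fibres, then its source has as many
connected components as its range has points. -/
lemma nonempty_connectedComponents_equiv_range {X D : Type*} [TopologicalSpace X]
    [TopologicalSpace D] [DiscreteTopology D] {f : X → D} (hf : Continuous f)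
    (hfib : ∀ d, IsPreconnected (f ⁻¹' {d})) : Nonempty (ConnectedComponents X ≃ range f) := by
  have hinj : Function.Injective hf.connectedComponentsLift := by
    intro a b
    obtain ⟨x, rfl⟩ := ConnectedComponents.surjective_coe a
    obtain ⟨y, rfl⟩ := ConnectedComponents.surjective_coe b
    intro h
    rw [Continuous.connectedComponentsLift_apply_coe,
      Continuous.connectedComponentsLift_apply_coe] at h
    rw [ConnectedComponents.coe_eq_coe']
    exact (hfib (f y)).subset_connectedComponent rfl h
  have hrange : range hf.connectedComponentsLift = range f := by
    ext d
    constructor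
    · rintro ⟨a, rfl⟩
      obtain ⟨x, rfl⟩ := ConnectedComponents.surjective_coe a
      exact ⟨x, (Continuous.connectedComponentsLift_apply_coe hf x).symm⟩
    · rintro ⟨x, rfl⟩
      exact ⟨x, Continuous.connectedComponentsLift_apply_coe hf x⟩
  exact ⟨(Equiv.ofInjective _ hinj).trans (Equiv.setCongr hrange)⟩

lemma floor_lt_of_sin_mul_pi_ne_zero {t : ℝ} (h : Real.sin (t * Real.pi) ≠ 0) :
    (⌊t⌋ : ℝ) < t ∧ t < ⌊t⌋ + 1 := by
  refine ⟨lt_of_le_of_ne (Int.floor_le t) fun he => h ?_, Int.lt_floor_add_one t⟩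
  rw [← he]
  exact Real.sin_int_mul_pi _

lemma sin_mul_pi_ne_zero {t : ℝ} {i : ℤ} (h1 : (i : ℝ) < t) (h2 : t < i + 1) :
    Real.sin (t * Real.pi) ≠ 0 := by
  intro h
  obtain ⟨k, hk⟩ := Real.sin_eq_zero_iff.1 h
  have hkt : (k : ℝ) = t := mul_right_cancel₀ Real.pi_ne_zero hk
  rw [← hkt] at h1 h2
  have h1' : i < k := by exact_mod_cast h1
  have h2' : k < i + 1 := by exact_mod_cast h2
  omega

/-- The index of the nodal domain of the mode `(m, n)` containing `p`. -/
def cellIndex (α : ℝ) (m n : ℕ) (p : ℝ × ℝ) : ℤ × ℤ :=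
  (⌊m * p.1 / (α * Real.pi)⌋, ⌊n * p.2 / Real.pi⌋)

/-- The cells cut out by the zero set of the mode `(m, n)`. -/
def cell (α : ℝ) (m n : ℕ) (d : ℤ × ℤ) : Set (ℝ × ℝ) :=
  Ioo (α * Real.pi / m * d.1) (α * Real.pi / m * (d.1 + 1)) ×ˢ
    Ioo (Real.pi / n * d.2) (Real.pi / n * (d.2 + 1))

lemma mem_Ioo_iff_floor {c : ℝ} (hc : 0 < c) {m : ℕ} (hm : 0 < m) (i : ℤ) (x : ℝ) :
    x ∈ Ioo (c / m * i) (c / m * (i + 1)) ↔ (i : ℝ) < m * x / c ∧ m * x / c < i + 1 := by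
  have hm' : (0 : ℝ) < m := by exact_mod_cast hm
  rw [mem_Ioo, lt_div_iff₀ hc, div_lt_iff₀ hc, div_mul_eq_mul_div, div_mul_eq_mul_div,
    div_lt_iff₀ hm', lt_div_iff₀ hm', mul_comm c, mul_comm x, mul_comm c]

variable {α : ℝ} {m n : ℕ}

/-- sin(tπ) ≠ 0 exactly when t is not an integer, that is, when t lies strictly above its floor. The
index is defined on the zero lines too, but there the point misses the open cell. -/
lemma sineMode_ne_zero_iff (hα : 0 < α) (hm : 0 < m) (hn : 0 < n) (p : ℝ × ℝ) :
    sineMode α m n p ≠ 0 ↔ p ∈ cell α m n (cellIndex α m n p) := by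
  have e1 : Real.sin (m * p.1 / α) = Real.sin (m * p.1 / (α * Real.pi) * Real.pi) := by
    congr 1
    field_simp
  have e2 : Real.sin (n * p.2) = Real.sin (n * p.2 / Real.pi * Real.pi) := by
    rw [div_mul_cancel₀ _ Real.pi_ne_zero]
  rw [cell, mem_prod, mem_Ioo_iff_floor (mul_pos hα Real.pi_pos) hm,
    mem_Ioo_iff_floor Real.pi_pos hn, sineMode, mul_ne_zero_iff, e1, e2]
  exact and_congr
    ⟨floor_lt_of_sin_mul_pi_ne_zero, fun h => sin_mul_pi_ne_zero h.1 h.2⟩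
    ⟨floor_lt_of_sin_mul_pi_ne_zero, fun h => sin_mul_pi_ne_zero h.1 h.2⟩

lemma cellIndex_eq_of_mem_cell (hα : 0 < α) (hm : 0 < m) (hn : 0 < n) {p : ℝ × ℝ} {d : ℤ × ℤ}
    (hp : p ∈ cell α m n d) : cellIndex α m n p = d := by
  rw [cell, mem_prod, mem_Ioo_iff_floor (mul_pos hα Real.pi_pos) hm,
    mem_Ioo_iff_floor Real.pi_pos hn] at hp
  exact Prod.ext (Int.floor_eq_iff.2 ⟨hp.1.1.le, hp.1.2⟩)
    (Int.floor_eq_iff.2 ⟨hp.2.1.le, hp.2.2⟩)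

/-- No cell straddles an end of (0, c), because 0 and c are themselves endpoints of cells. -/
lemma mem_Ioo_iff_mem_Ico {c : ℝ} (hc : 0 < c) (hm : 0 < m) (i : ℤ) {x : ℝ}
    (hx : x ∈ Ioo (c / m * i) (c / m * (i + 1))) : x ∈ Ioo 0 c ↔ i ∈ Ico 0 (m : ℤ) := by
  have hm' : (0 : ℝ) < m := by exact_mod_cast hm
  rw [mem_Ioo_iff_floor hc hm] at hx
  have e1 : 0 < x ↔ 0 < m * x / c := by
    rw [lt_div_iff₀ hc, zero_mul, mul_pos_iff_of_pos_left hm']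
  have e2 : x < c ↔ m * x / c < m := by
    rw [div_lt_iff₀ hc, mul_lt_mul_iff_right₀ hm']
  rw [mem_Ioo, e1, e2, mem_Ico]
  constructor
  · rintro ⟨h1, h2⟩
    have h3 : (-1 : ℝ) < i := by linarith [hx.2]
    have h4 : (i : ℝ) < m := hx.1.trans h2
    have h3' : -1 < i := by exact_mod_cast h3
    exact ⟨by omega, by exact_mod_cast h4⟩
  · rintro ⟨h1, h2⟩
    have h1' : (0 : ℝ) ≤ i := by exact_mod_cast h1
    have h2' : (i : ℝ) + 1 ≤ m := by exact_mod_cast h2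
    exact ⟨h1'.trans_lt hx.1, hx.2.trans_le h2'⟩

/-- The number of nodal domains of a sine mode. -/
theorem nodalDomain_sineMode (hα : 0 < α) (hm : 0 < m) (hn : 0 < n) :
    Finite (NodalDomain (rectangle α) (sineMode α m n)) ∧
      Nat.card (NodalDomain (rectangle α) (sineMode α m n)) = m * n := by
  let X := {p : ℝ × ℝ // p ∈ rectangle α ∧ sineMode α m n p ≠ 0}
  let f : X → ℤ × ℤ := fun p => cellIndex α m n p.1
  have hcellOpen : ∀ d, IsOpen (cell α m n d) := fun d => isOpen_Ioo.prod isOpen_Ioo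
  have hmem : ∀ p : X, p.1 ∈ cell α m n (f p) := fun p =>
    (sineMode_ne_zero_iff hα hm hn p.1).1 p.2.2
  have hfib : ∀ d, f ⁻¹' {d} = (Subtype.val : X → ℝ × ℝ) ⁻¹' cell α m n d := by
    intro d
    ext p
    constructor
    · intro h
      have h : f p = d := h
      exact h ▸ hmem p
    · exact fun h => cellIndex_eq_of_mem_cell hα hm hn h
  -- The floor is locally constant here because the zero lines have been removed: each fibre is the
  -- trace of an open cell.
  have hf : Continuous f := by
    rw [continuous_discrete_rng]
    intro d
    rw [hfib]
    exact (hcellOpen d).preimage continuous_subtype_val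
  have hrect : ∀ d : ℤ × ℤ, ∀ p ∈ cell α m n d,
      p ∈ rectangle α ↔ d ∈ Ico (0 : ℤ) m ×ˢ Ico (0 : ℤ) n := fun d p hp =>
    and_congr (mem_Ioo_iff_mem_Ico (mul_pos hα Real.pi_pos) hm d.1 hp.1)
      (mem_Ioo_iff_mem_Ico Real.pi_pos hn d.2 hp.2)
  have hX : ∀ d : ℤ × ℤ, d ∈ Ico (0 : ℤ) m ×ˢ Ico (0 : ℤ) n → ∀ p ∈ cell α m n d,
      p ∈ rectangle α ∧ sineMode α m n p ≠ 0 := by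
    intro d hd p hp
    refine ⟨(hrect d p hp).2 hd, ?_⟩
    rw [sineMode_ne_zero_iff hα hm hn, cellIndex_eq_of_mem_cell hα hm hn hp]
    exact hp
  have hrange : range f = Ico (0 : ℤ) m ×ˢ Ico (0 : ℤ) n := by
    ext d
    constructor
    · rintro ⟨p, rfl⟩
      exact (hrect _ p.1 (hmem p)).1 p.2.1
    · intro hd
      have hm' : (0 : ℝ) < m := by exact_mod_cast hm
      have hn' : (0 : ℝ) < n := by exact_mod_cast hn
      have hne : (cell α m n d).Nonempty := by
        refine (nonempty_Ioo.2 ?_).prod (nonempty_Ioo.2 ?_)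
        · exact mul_lt_mul_of_pos_left (lt_add_one _)
            (div_pos (mul_pos hα Real.pi_pos) hm')
        · exact mul_lt_mul_of_pos_left (lt_add_one _) (div_pos Real.pi_pos hn')
      obtain ⟨p, hp⟩ := hne
      exact ⟨⟨p, hX d hd p hp⟩, cellIndex_eq_of_mem_cell hα hm hn hp⟩
  -- A nonempty fibre is an entire cell, a product of two intervals.
  have hconn : ∀ d, IsPreconnected (f ⁻¹' {d}) := by
    intro d
    by_cases hd : d ∈ Ico (0 : ℤ) m ×ˢ Ico (0 : ℤ) n
    · refine (Topology.IsInducing.isPreconnected_image (f := (Subtype.val : X → ℝ × ℝ)) ⟨rfl⟩).1 ?_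
      rw [hfib, image_preimage_eq_of_subset]
      · exact isPreconnected_Ioo.prod isPreconnected_Ioo
      · exact fun p hp => ⟨⟨p, hX d hd p hp⟩, rfl⟩
    · have : f ⁻¹' {d} = ∅ := by
        rw [preimage_singleton_eq_empty, hrange]
        exact hd
      rw [this]
      exact isPreconnected_empty
  obtain ⟨e⟩ := nonempty_connectedComponents_equiv_range hf hconn
  have hfin : (range f).Finite := by
    rw [hrange]
    exact (finite_Ico _ _).prod (finite_Ico _ _)
  have : Finite (range f) := hfin
  refine ⟨Finite.of_equiv _ e.symm, ?_⟩
  rw [Nat.card_congr e, Nat.card_coe_set_eq, hrange, ncard_prod, ← Finset.coe_Ico,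
    ← Finset.coe_Ico, ncard_coe_finset, ncard_coe_finset]
  simp

end DirichletNodal

end

/-! ### The nodal deficiency formula -/

theorem mainTheorem5 (α : ℝ) (hα : 0 < α) (m n : ℕ) (hm : 0 < m) (hn : 0 < n) :
    DirichletNodal.IsEigenfunction (DirichletNodal.rectangle α)
        (DirichletNodal.modeEigenvalue α m n) (DirichletNodal.sineMode α m n) ∧
      Finite (DirichletNodal.NodalDomain (DirichletNodal.rectangle α)
        (DirichletNodal.sineMode α m n)) ∧
      (DirichletNodal.latticePoints
        (DirichletNodal.quarterEllipse α (DirichletNodal.modeEigenvalue α m n) \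
          DirichletNodal.indexRectangle m n)).Finite ∧
      ∃ lam : ℕ+ → ℝ,
        (∀ lam' : ℕ+ → ℝ,
          DirichletNodal.IsEigenvalueSequence (DirichletNodal.rectangle α) lam' ↔ lam' = lam) ∧
        (∃ k : ℕ+, lam k = DirichletNodal.modeEigenvalue α m n) ∧
        DirichletNodal.nodalDeficiency (DirichletNodal.rectangle α) lam
            (DirichletNodal.modeEigenvalue α m n) (DirichletNodal.sineMode α m n) =
          ((DirichletNodal.latticePoints
            (DirichletNodal.quarterEllipse α (DirichletNodal.modeEigenvalue α m n) \
              DirichletNodal.indexRectangle m n)).ncard : ℤ) := by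
  obtain ⟨hlat, hcount⟩ := DirichletNodal.ncard_modeEigenvalue_lt hα hm hn
  obtain ⟨hnodal, hcard⟩ := DirichletNodal.nodalDomain_sineMode hα hm hn
  have hfin := DirichletNodal.finite_modeEigenvalue_le hα
  have hrank : ∀ μ, Cardinal.toENat (Module.rank ℝ
      (DirichletNodal.eigenspace (DirichletNodal.rectangle α) μ)) =
      {p : ℕ+ × ℕ+ | DirichletNodal.modeEigenvalue α p.1 p.2 = μ}.encard := fun μ =>
    DirichletNodal.toENat_rank_eigenspace_rectangle hα
      ((hfin μ).subset fun p (hp : DirichletNodal.modeEigenvalue α p.1 p.2 = μ) => hp.le)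
  obtain ⟨lam, hmono, hlam⟩ := DirichletNodal.exists_monotone_encard_fiber_eq hfin
  have hfirst : (∃ k, lam k = DirichletNodal.modeEigenvalue α m n) ∧
      DirichletNodal.firstIndex lam (DirichletNodal.modeEigenvalue α m n) =
      {p : ℕ+ × ℕ+ | DirichletNodal.modeEigenvalue α p.1 p.2 <
        DirichletNodal.modeEigenvalue α m n}.ncard + 1 :=
    DirichletNodal.firstIndex_eq hfin hmono hlam (⟨m, hm⟩, ⟨n, hn⟩)
  refine ⟨DirichletNodal.isEigenfunction_sineMode hα hm hn, hnodal, hlat, lam, fun lam' => ⟨?_, ?_⟩,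
    hfirst.1, ?_⟩
  · rintro ⟨hm', h'⟩
    exact DirichletNodal.eq_of_monotone_of_encard_fiber_eq hfin hmono hm' hlam
      fun μ => (h' μ).trans (hrank μ)
  · rintro rfl
    exact ⟨hmono, fun μ => (hlam μ).trans (hrank μ).symm⟩
  · rw [DirichletNodal.nodalDeficiency, hfirst.2, hcard]
    omega
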